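/- Let $H$ be a real Hilbert space and let $\mathcal A$ be a positive self-adjoint (in general unbounded, densely defined) operator on $H$, with positive self-adjoint square root $\mathcal A^{1/2}$; the domain $\mathcal D(\mathcal A^{1/2})$ carries the graph norm $(\|u\|^2+\|\mathcal A^{1/2}u\|^2)^{1/2}$. Let $\tau>0$, $b>0$, $\alpha,c\in\mathbb R$, and let $g:[0,\infty)\to(0,\infty)$. Consider the Moore--Gibson--Thompson equation with memory $$\tau u_{ttt}+\alpha u_{tt}+c^2\mathcal A u+b\mathcal A u_t-\int_0^t g(t-s)\,\mathcal A u(s)\,ds=0,\qquad u(0)=u_0,\ u_t(0)=u_1,\ u_{tt}(0)=u_2. \tag{1}$$ **Assumption.** Put $\gamma=\alpha-\frac{c^2\tau}{b}$. 1. $g\in C^1([0,\infty))$, $g(t)>0$ for all $t\ge 0$, $g(0)<\frac{b\alpha\gamma}{\tau^2}$ and $\int_0^\infty g(s)\,ds<c^2$. 2. There is a convex, strictly increasing function $K\in C^1([0,\infty))$ with $K(0)=0$ such that $g'(t)+K(g(t))\le 0$ for all $t>0$. 3. The solution $y\ge 0$ of $y'+K(y)=0$ on $[0,\infty)$, $y(0)=g(0)$,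 satisfies $y^{1-\alpha_0}\in L^1(0,\infty)$ for some $\alpha_0\in(0,1)$. 4. There is $\bar\delta>0$ such that $K\in C^2(0,\bar\delta)$ and $x^2K''(x)-xK'(x)+K(x)\ge 0$ for all $x\in(0,\bar\delta)$. 5. There is a constant $\lambda_0$ such that $\|u\|\le\lambda_0\|\mathcal A^{1/2}u\|$ for all $u\in\mathcal D(\mathcal A^{1/2})$. 6. $\gamma>0$. **Weak solution.** A function $u:[0,\infty)\to\mathcal D(\mathcal A^{1/2})$ is a weak solution of (1) if there are $v\in L^2_{loc}([0,\infty);\mathcal D(\mathcal A^{1/2}))$ and $w\in L^2_{loc}([0,\infty);H)$ (the weak derivatives $v=u_t$, $w=u_{tt}$) such that $u(t)=u_0+\int_0^t v\,ds$ for all $t\ge 0$, $v(t)=u_1+\int_0^t w\,ds$ for a.e. $t>0$, and, for every $\varphi\in\mathcal D(\mathcal A^{1/2})$ and a.e. $t>0$, $$\tau(w(t),\varphi)+\int_0^t\Big[\alpha(w,\varphi)+c^2(\mathcal A^{1/2}u,\mathcal A^{1/2}\varphi)+b(\mathcal A^{1/2}v,\mathcal A^{1/2}\varphi)-\int_0^s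 g(s-r)(\mathcal A^{1/2}u(r),\mathcal A^{1/2}\varphi)\,dr\Big]ds=\tau(u_2,\varphi).$$ **Theorem.** Under the Assumption, for every $(u_0,u_1,u_2)\in\mathcal D(\mathcal A^{1/2})\times\mathcal D(\mathcal A^{1/2})\times H$, problem (1) has a unique weak solution $u$. Moreover $$u\in C^1([0,\infty);\mathcal D(\mathcal A^{1/2}))\cap C^2([0,\infty);H),$$ and $u_t(0)=u_1$, $u_{tt}(0)=u_2$ hold for the (one-sided at $0$) classical derivatives. -/

import Mathlib

open Set MeasureTheory
open scoped ContDiff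

namespace MGT

/-- `A` is a positive self-adjoint (in general unbounded, densely defined) operator on `H`. Density of
the domain is part of Mathlib's self-adjointness (`IsSelfAdjoint.dense_domain`). -/
structure IsPositiveSelfAdjoint {H : Type*} [NormedAddCommGroup H] [InnerProductSpace ℝ H]
    [CompleteSpace H] (A : H →ₗ.[ℝ] H) : Prop where
  isSelfAdjoint : IsSelfAdjoint A
  nonneg : ∀ x : A.domain, 0 ≤ inner ℝ (A x) (x : H)

/-- `S` is the positive self-adjoint square root of `A`: `S` is positive self-adjoint and `S ∘ S = A`,
with equality of domains (expressed through graphs). Such an `S` exists and is unique whenever `A` is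
positive self-adjoint. -/
def IsSqrt {H : Type*} [NormedAddCommGroup H] [InnerProductSpace ℝ H] [CompleteSpace H]
    (A S : H →ₗ.[ℝ] H) : Prop :=
  IsPositiveSelfAdjoint S ∧
    ∀ x z : H, (x, z) ∈ A.graph ↔ ∃ y : H, (x, y) ∈ S.graph ∧ (y, z) ∈ S.graph

open Classical in
/-- The operator `A^{1/2}` (with the junk value `0` if `A` has no positive self-adjoint square root). -/
noncomputable def sqrtOp {H : Type*} [NormedAddCommGroup H] [InnerProductSpace ℝ H] [CompleteSpace H]
    (A : H →ₗ.[ℝ] H) : H →ₗ.[ℝ] H :=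
  if h : ∃ S : H →ₗ.[ℝ] H, IsSqrt A S then h.choose else 0

/-- The space `D(A^{1/2})`, a type synonym for the domain of `A^{1/2}`, carrying the graph norm
`‖u‖² + ‖A^{1/2} u‖²` (and not the norm of `H`). -/
def EnergySpace {H : Type*} [NormedAddCommGroup H] [InnerProductSpace ℝ H] [CompleteSpace H]
    (A : H →ₗ.[ℝ] H) : Type _ :=
  (sqrtOp A).domain

namespace EnergySpace

variable {H : Type*} [NormedAddCommGroup H] [InnerProductSpace ℝ H] [CompleteSpace H]
  (A : H →ₗ.[ℝ] H)

noncomputable instance instAddCommGroup : AddCommGroup (EnergySpace A) :=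
  inferInstanceAs (AddCommGroup (sqrtOp A).domain)

noncomputable instance instModule : Module ℝ (EnergySpace A) :=
  inferInstanceAs (Module ℝ (sqrtOp A).domain)

/-- The inclusion `D(A^{1/2}) → H`. -/
noncomputable def incl : EnergySpace A →ₗ[ℝ] H := (sqrtOp A).domain.subtype

/-- The map `A^{1/2} : D(A^{1/2}) → H`. -/
noncomputable def half : EnergySpace A →ₗ[ℝ] H := (sqrtOp A).toFun

/-- The embedding `u ↦ (u, A^{1/2} u)` onto the graph of `A^{1/2}`. -/
noncomputable def toGraph : EnergySpace A →ₗ[ℝ] WithLp 2 (H × H) :=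
  (WithLp.linearEquiv 2 ℝ (H × H)).symm.toLinearMap ∘ₗ (incl A).prod (half A)

theorem toGraph_injective : Function.Injective (toGraph A) := by
  intro x y h
  have h2 := congrArg (fun p => (WithLp.ofLp p).1) h
  exact Subtype.ext h2

noncomputable instance instNormedAddCommGroup : NormedAddCommGroup (EnergySpace A) :=
  NormedAddCommGroup.induced (EnergySpace A) (WithLp 2 (H × H)) (toGraph A) (toGraph_injective A)

noncomputable instance instNormedSpace : NormedSpace ℝ (EnergySpace A) :=
  NormedSpace.induced ℝ (EnergySpace A) (WithLp 2 (H × H)) (toGraph A)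

theorem norm_sq_eq (u : EnergySpace A) : ‖u‖ ^ 2 = ‖incl A u‖ ^ 2 + ‖half A u‖ ^ 2 := by
  have h : ‖u‖ = ‖toGraph A u‖ := rfl
  rw [h, WithLp.prod_norm_sq_eq_of_L2]
  rfl

end EnergySpace

/-- The standing assumption on the memory kernel `g` (a function on `[0, ∞)`; its values at negative
arguments play no role), the operator `A` and the parameters. -/
structure StandingAssumption {H : Type*} [NormedAddCommGroup H] [InnerProductSpace ℝ H]
    [CompleteSpace H] (A : H →ₗ.[ℝ] H) (τ α b c : ℝ) (g : ℝ → ℝ) : Prop where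
  /-- `g ∈ C¹([0, ∞))` -/
  contDiffOn_g : ContDiffOn ℝ 1 g (Ici 0)
  g_pos : ∀ t, 0 ≤ t → 0 < g t
  g_zero_lt : g 0 < b * α * (α - c ^ 2 * τ / b) / τ ^ 2
  /-- `G(+∞) = ∫₀^∞ g` is finite ... -/
  integrable_g : IntegrableOn g (Ioi 0)
  /-- ... and `G(+∞) < c²` -/
  integral_g_lt : ∫ t in Ioi (0 : ℝ), g t < c ^ 2
  /-- the convex function `K` on `[0, ∞)` that controls the decay of `g`, the solution `y` of
  `y' + K(y) = 0`, `y(0) = g(0)` on `[0, ∞)`, the exponent `α₀` and the number `δ` -/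
  exists_decay : ∃ K : ℝ → ℝ,
    (ConvexOn ℝ (Ici 0) K ∧ ContDiffOn ℝ 1 K (Ici 0) ∧ StrictMonoOn K (Ici 0) ∧ K 0 = 0 ∧
      ∀ t, 0 < t → deriv g t + K (g t) ≤ 0) ∧
    (∃ y : ℝ → ℝ, y 0 = g 0 ∧ (∀ t, 0 ≤ t → 0 ≤ y t) ∧
      (∀ t, 0 ≤ t → HasDerivWithinAt y (-K (y t)) (Ici 0) t) ∧
      ∃ α₀ ∈ Ioo (0 : ℝ) 1, IntegrableOn (fun t => y t ^ (1 - α₀)) (Ioi 0)) ∧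
    (∃ δ : ℝ, 0 < δ ∧ ContDiffOn ℝ 2 K (Ioo 0 δ) ∧
      ∀ x ∈ Ioo 0 δ, 0 ≤ x ^ 2 * deriv (deriv K) x - x * deriv K x + K x)
  /-- `‖u‖ ≤ λ₀ ‖A^{1/2} u‖` on `D(A^{1/2})` -/
  coercive : ∃ lam : ℝ, ∀ u : EnergySpace A,
    ‖EnergySpace.incl A u‖ ≤ lam * ‖EnergySpace.half A u‖
  gamma_pos : 0 < α - c ^ 2 * τ / b

/-- `u : [0, ∞) → D(A^{1/2})` is a weak solution of
`τ u_ttt + α u_tt + c² A u + b A u_t - ∫₀ᵗ g(t-s) A u(s) ds = 0`, `u(0) = u₀`, `u_t(0) = u₁`,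
`u_tt(0) = u₂`: it has weak derivatives `u_t = v ∈ L²_loc([0, ∞); D(A^{1/2}))` and
`u_tt = w ∈ L²_loc([0, ∞); H)`, and for every test vector `φ ∈ D(A^{1/2})` the function
`t ↦ τ (u_tt, φ)` is (after modification on a null set) locally absolutely continuous with initial
value `τ (u₂, φ)` and a.e. derivative
`-[α (u_tt, φ) + c² (A^{1/2}u, A^{1/2}φ) + b (A^{1/2}u_t, A^{1/2}φ)
  - ∫₀ᵗ g(t-s) (A^{1/2}u(s), A^{1/2}φ) ds]`. -/
def IsWeakSolution {H : Type*} [NormedAddCommGroup H] [InnerProductSpace ℝ H] [CompleteSpace H]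
    (A : H →ₗ.[ℝ] H) (τ α b c : ℝ) (g : ℝ → ℝ) (u₀ u₁ : EnergySpace A) (u₂ : H)
    (u : ℝ → EnergySpace A) : Prop :=
  ∃ (v : ℝ → EnergySpace A) (w : ℝ → H),
    (∀ T : ℝ, MemLp v 2 (volume.restrict (Ioc 0 T))) ∧
    (∀ T : ℝ, MemLp w 2 (volume.restrict (Ioc 0 T))) ∧
    (∀ t : ℝ, 0 ≤ t → u t = u₀ + ∫ s in (0 : ℝ)..t, v s) ∧
    (∀ᵐ t ∂(volume.restrict (Ioi (0 : ℝ))),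
      EnergySpace.incl A (v t) = EnergySpace.incl A u₁ + ∫ s in (0 : ℝ)..t, w s) ∧
    ∀ φ : EnergySpace A, ∀ᵐ t ∂(volume.restrict (Ioi (0 : ℝ))),
      τ * inner ℝ (w t) (EnergySpace.incl A φ) +
        ∫ s in (0 : ℝ)..t,
          (α * inner ℝ (w s) (EnergySpace.incl A φ)
            + c ^ 2 * inner ℝ (EnergySpace.half A (u s)) (EnergySpace.half A φ)
            + b * inner ℝ (EnergySpace.half A (v s)) (EnergySpace.half A φ)
            - ∫ r in (0 : ℝ)..s,
                g (s - r) * inner ℝ (EnergySpace.half A (u r)) (EnergySpace.half A φ))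
      = τ * inner ℝ u₂ (EnergySpace.incl A φ)

end MGT

/-! ### Contraction semigroups whose generator has a bounded skew-symmetric inverse -/

section Semigroup

open Filter Topology NormedSpace

variable {X : Type*} [NormedAddCommGroup X] [InnerProductSpace ℝ X] [CompleteSpace X]

/-! By coercivity, A^{1/2} maps D(A^{1/2}) isomorphically onto H, and its inverse T is a bounded
self-adjoint operator on H with dense range (`exists_half_equiv`). Put p = A^{1/2} u_t, q = u_tt and
P = A^{1/2} u₀ + ∫ p. Applying T to the equation and integrating in time gives a system with bounded
operators only: T p = T p₀ + ∫ q and τ T q + α T ∫ q + ∫ (b p + c² P - g * P) = τ T q₀.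

The term b A u_t makes this hyperbolic. In the unknowns σ⁻¹ (b p + c² P - g * P) and q, with σ² = b
τ, the system is an abstract wave equation B U = B U₀ + ∫ U + B ∫ F with B bounded, skew-symmetric
and of dense range, so B⁻¹ generates a contraction semigroup (`exists_semigroup_of_skew`) and
Duhamel's formula solves for U when F is given (`exists_solution_operator_of_skew`). The forcing F
collects the damping α q and the rate c² p - g P₀ - g * p of the memory stress, in which p is not
differentiated. Since b ≠ 0, p is recovered from U by subtracting the memory stress, an integral of
p. Thus (p, q) is a fixed point of a causal map with a Volterra-type Lipschitz bound: an exponential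
weight gives existence, Grönwall's inequality uniqueness (`memory_system_wellPosed`). Continuity of
p and q is exactly the asserted regularity of u.

A general weak solution has A^{1/2} u_t only in L²_loc, so uniqueness for continuous (p, q) does not
apply to it directly. Integrating the weak form once more leaves an identity for the continuous pair
(A^{1/2} u, u_t). The difference of two such pairs solves the same system with zero data, hence
vanishes. -/

/-- The resolvent `L = (B - ε)⁻¹` of a bounded skew-symmetric operator `B`. -/
theorem exists_resolvent_of_skew (B : X →L[ℝ] X) (hB : ∀ x, inner ℝ (B x) x = 0) {ε : ℝ}
    (hε : 0 < ε) : ∃ L : X →L[ℝ] X, (∀ x, L (B x) = x + ε • L x) ∧ (∀ x, B (L x) = x + ε • L x) ∧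
      (∀ x, inner ℝ (L x) x ≤ 0) ∧ ∀ x, ‖ε • L x‖ ≤ ‖x‖ := by
  -- Skewness leaves only the shift in the quadratic form. This coercivity makes `B - ε` invertible;
  -- evaluated at `L x` it gives ⟨L x, x⟩ = -ε ‖L x‖², hence dissipativity and, by Cauchy–Schwarz,
  -- the bound on `ε • L`.
  have key : ∀ x, inner ℝ ((B - ε • (1 : X →L[ℝ] X)) x) x = -(ε * ‖x‖ ^ 2) := by
    intro x
    simp [inner_sub_left, hB, inner_smul_left]
  have hu : IsUnit (B - ε • (1 : X →L[ℝ] X)) := by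
    refine ContinuousLinearMap.isUnit_of_forall_le_norm_inner_map _ (c := ⟨ε, hε.le⟩) hε ?_
    intro x
    rw [key, norm_neg, Real.norm_of_nonneg (by positivity)]
    exact (mul_comm _ _).le
  obtain ⟨u, hu⟩ := hu
  have h1 : ∀ x, B ((↑u⁻¹ : X →L[ℝ] X) x) - ε • (↑u⁻¹ : X →L[ℝ] X) x = x := by
    intro x
    have h := DFunLike.congr_fun (Units.mul_inv u) x
    rw [hu] at h
    simpa using h
  have h2 : ∀ x, (↑u⁻¹ : X →L[ℝ] X) (B x) - ε • (↑u⁻¹ : X →L[ℝ] X) x = x := by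
    intro x
    have h := DFunLike.congr_fun (Units.inv_mul u) x
    rw [hu] at h
    simpa using h
  have h3 : ∀ x, inner ℝ ((↑u⁻¹ : X →L[ℝ] X) x) x = -(ε * ‖(↑u⁻¹ : X →L[ℝ] X) x‖ ^ 2) := by
    intro x
    have h := key ((↑u⁻¹ : X →L[ℝ] X) x)
    rw [real_inner_comm] at h
    simpa [h1] using h
  refine ⟨↑u⁻¹, fun x => ?_, fun x => ?_, fun x => ?_, fun x => ?_⟩
  · rw [← sub_eq_iff_eq_add]; exact h2 x
  · rw [← sub_eq_iff_eq_add]; exact h1 x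
  · rw [h3]; exact neg_nonpos.2 (by positivity)
  · have h := abs_real_inner_le_norm ((↑u⁻¹ : X →L[ℝ] X) x) x
    rw [h3, abs_neg, abs_of_nonneg (by positivity), norm_smul, Real.norm_of_nonneg hε.le] at *
    rcases eq_or_lt_of_le (norm_nonneg ((↑u⁻¹ : X →L[ℝ] X) x)) with h0 | h0
    · rw [← h0]; simp
    · refine le_of_mul_le_mul_left ?_ h0
      linarith

theorem hasDerivAt_exp_smul_apply (L : X →L[ℝ] X) (x : X) (t : ℝ) :
    HasDerivAt (fun s : ℝ => exp (s • L) x) (L (exp (t • L) x)) t :=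
  (hasDerivAt_exp_smul_const' (𝕂 := ℝ) L t).clm_apply (hasDerivAt_const t x) |>.congr_deriv
    (by simp)

theorem continuous_exp_smul_apply (L : X →L[ℝ] X) (x : X) :
    Continuous (fun s : ℝ => exp (s • L) x) :=
  continuous_iff_continuousAt.2 fun t => (hasDerivAt_exp_smul_apply L x t).continuousAt

theorem norm_exp_smul_apply_le {L : X →L[ℝ] X} (hL : ∀ x, inner ℝ (L x) x ≤ 0) {t : ℝ}
    (ht : 0 ≤ t) (x : X) : ‖exp (t • L) x‖ ≤ ‖x‖ := by
  have hanti : Antitone fun s : ℝ => ‖exp (s • L) x‖ ^ 2 := by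
    refine antitone_of_hasDerivAt_nonpos (fun s => (hasDerivAt_exp_smul_apply L x s).norm_sq) ?_
    intro s
    have := hL (exp (s • L) x)
    rw [real_inner_comm] at this
    simp only [Pi.zero_apply]
    linarith
  have h := hanti ht
  simp only [zero_smul, exp_zero, one_apply_eq_self] at h
  exact (pow_le_pow_iff_left₀ (norm_nonneg _) (norm_nonneg _) two_ne_zero).1 h

omit [CompleteSpace X] in
theorem exp_smul_apply_comm {L M : X →L[ℝ] X} (h : ∀ x, L (M x) = M (L x)) (t : ℝ) (x : X) :
    exp (t • L) (M x) = M (exp (t • L) x) := by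
  have hc : Commute M (t • L) := by
    refine Commute.smul_right ?_ t
    ext x
    exact (h x).symm
  exact (DFunLike.congr_fun (hc.exp_right).eq x).symm

/-- The curve s ↦ e^{(t-s)L} e^{sM} x joins e^{tL} x to e^{tM} x. Its derivative is e^{(t-s)L} (M -
L) e^{sM} x, and the outer exponential is a contraction, so the mean value inequality applies. -/
theorem norm_exp_smul_sub_exp_smul_le {L M : X →L[ℝ] X} (hL : ∀ x, inner ℝ (L x) x ≤ 0)
    {x : X} {C : ℝ} (hC : ∀ s : ℝ, 0 ≤ s → ‖M (exp (s • M) x) - L (exp (s • M) x)‖ ≤ C) {t : ℝ}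
    (ht : 0 ≤ t) : ‖exp (t • M) x - exp (t • L) x‖ ≤ C * t := by
  have hd : ∀ s ∈ Icc 0 t, HasDerivWithinAt (fun s : ℝ => exp ((t - s) • L) (exp (s • M) x))
      (exp ((t - s) • L) (M (exp (s • M) x) - L (exp (s • M) x))) (Icc 0 t) s := by
    intro s _
    have h1 : HasDerivAt (fun s : ℝ => exp ((t - s) • L)) (-(L * exp ((t - s) • L))) s := by
      have := (hasDerivAt_exp_smul_const' (𝕂 := ℝ) L (t - s)).scomp s
        ((hasDerivAt_id s).const_sub t)
      simpa [Function.comp_def] using this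
    have h2 := h1.clm_apply (hasDerivAt_exp_smul_apply M x s)
    refine (h2.congr_deriv ?_).hasDerivWithinAt
    rw [map_sub, exp_smul_apply_comm (M := L) (fun _ => rfl)]
    simp [sub_eq_add_neg, add_comm]
  have h := (convex_Icc 0 t).norm_image_sub_le_of_norm_hasDerivWithin_le (C := C) hd
    (fun s hs => (norm_exp_smul_apply_le hL (sub_nonneg.2 hs.2) _).trans (hC s hs.1))
    (left_mem_Icc.2 ht) (right_mem_Icc.2 ht)
  simpa [abs_of_nonneg ht] using h

theorem norm_exp_smul_sub_le {L : X →L[ℝ] X} (hL : ∀ x, inner ℝ (L x) x ≤ 0) (x : X) {s t : ℝ}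
    (hs : 0 ≤ s) (ht : 0 ≤ t) : ‖exp (t • L) x - exp (s • L) x‖ ≤ ‖L x‖ * |t - s| := by
  refine (convex_Ici (0 : ℝ)).norm_image_sub_le_of_norm_hasDerivWithin_le (C := ‖L x‖)
    (fun r _ => (hasDerivAt_exp_smul_apply L x r).hasDerivWithinAt) (fun r hr => ?_) hs ht
  rw [← exp_smul_apply_comm (M := L) (fun _ => rfl)]
  exact norm_exp_smul_apply_le hL hr _

omit [CompleteSpace X] in
theorem cauchySeq_apply_of_dense {f : ℕ → X →L[ℝ] X} (hf : ∀ n x, ‖f n x‖ ≤ ‖x‖) {s : Set X}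
    (hs : Dense s) (h : ∀ x ∈ s, CauchySeq fun n => f n x) (x : X) : CauchySeq fun n => f n x := by
  rw [Metric.cauchySeq_iff]
  intro ε hε
  obtain ⟨y, hy, hxy⟩ := Metric.dense_iff.1 hs x (ε / 3) (by positivity)
  obtain ⟨N, hN⟩ := Metric.cauchySeq_iff.1 (h y hxy) (ε / 3) (by positivity)
  refine ⟨N, fun m hm n hn => ?_⟩
  rw [Metric.mem_ball, dist_eq_norm] at hy
  have h1 := hN m hm n hn
  rw [dist_eq_norm] at *
  have h2 := hf m (y - x)
  have h3 := hf n (y - x)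
  rw [map_sub] at h2 h3
  calc ‖f m x - f n x‖ = ‖(f m y - f n y) - (f m y - f m x) + (f n y - f n x)‖ := by
        congr 1; abel
    _ ≤ ‖f m y - f n y‖ + ‖f m y - f m x‖ + ‖f n y - f n x‖ :=
        (norm_add_le _ _).trans (add_le_add_left (norm_sub_le _ _) _)
    _ < ε := by linarith

/-- A densely defined operator whose inverse is a bounded skew-symmetric operator `B` generates a
strongly continuous contraction semigroup (extended by the identity to negative times). -/
theorem exists_semigroup_of_skew (B : X →L[ℝ] X) (hB : ∀ x, inner ℝ (B x) x = 0)
    (hd : DenseRange B) : ∃ E : ℝ → X →L[ℝ] X, (∀ t x, ‖E t x‖ ≤ ‖x‖) ∧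
      Continuous (fun p : ℝ × X => E p.1 p.2) ∧
      ∀ t, 0 ≤ t → ∀ x, B (E t x) = B x + ∫ s in (0 : ℝ)..t, E s x := by
  have hε : ∀ n : ℕ, (0 : ℝ) < 1 / ((n : ℝ) + 1) := fun n => Nat.one_div_pos_of_nat
  have hε0 : Tendsto (fun n : ℕ => 1 / ((n : ℝ) + 1)) atTop (𝓝 0) :=
    tendsto_one_div_add_atTop_nhds_zero_nat
  choose L hLB hBL hLd hLn using fun n : ℕ => exists_resolvent_of_skew B hB (hε n)
  set ε : ℕ → ℝ := fun n => 1 / ((n : ℝ) + 1)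
  -- The resolvent identity: the bounded generators `L n` differ by a factor `ε m - ε n`, at the
  -- price of a product of two resolvents that are not uniformly bounded.
  have hdiff : ∀ m n x, L m x - L n x = (ε m - ε n) • L m (L n x) := by
    intro m n x
    have h1 := hLB m (L n x)
    rw [hBL, map_add, map_smul] at h1
    rw [sub_smul, sub_eq_sub_iff_add_eq_add, h1, add_comm]
  have hcomm : ∀ n x, L n (B x) = B (L n x) := fun n x => (hLB n x).trans (hBL n x).symm
  have hLBn : ∀ n x, ‖L n (B x)‖ ≤ 2 * ‖x‖ := by
    intro n x
    rw [hLB]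
    linarith [norm_add_le x (ε n • L n x), hLn n x]
  -- On the range of `B²` each factor `B` absorbs one resolvent, because `L n ∘ B = 1 + ε n • L n`
  -- has norm at most 2. Hence the uniform constant 4 = 2 · 2.
  have hrate : ∀ m n z (t : ℝ), 0 ≤ t →
      ‖exp (t • L n) (B (B z)) - exp (t • L m) (B (B z))‖ ≤ |ε n - ε m| * (4 * ‖z‖) * t := by
    intro m n z t ht
    refine norm_exp_smul_sub_exp_smul_le (hLd m) (fun s hs => ?_) ht
    rw [norm_sub_rev, hdiff, norm_smul, Real.norm_eq_abs, abs_sub_comm]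
    refine mul_le_mul_of_nonneg_left ?_ (abs_nonneg _)
    rw [exp_smul_apply_comm (hcomm n), hcomm n]
    refine (hLBn m _).trans ?_
    rw [← exp_smul_apply_comm (M := L n) (fun _ => rfl)]
    linarith [norm_exp_smul_apply_le (hLd n) hs (L n (B z)), hLBn n z]
  have hdd : Dense (range fun z => B (B z)) := hd.comp hd B.continuous
  have hcauchy : ∀ t : ℝ, 0 ≤ t → ∀ x, CauchySeq fun n => exp (t • L n) x := by
    intro t ht
    refine cauchySeq_apply_of_dense (fun n x => norm_exp_smul_apply_le (hLd n) ht x) hdd ?_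
    rintro _ ⟨z, rfl⟩
    have hεc : CauchySeq fun n => (4 * ‖z‖ * t) * ε n :=
      (hε0.const_mul (4 * ‖z‖ * t)).cauchySeq
    rw [Metric.cauchySeq_iff] at hεc ⊢
    intro δ hδ
    obtain ⟨N, hN⟩ := hεc δ hδ
    refine ⟨N, fun m hm n hn => lt_of_le_of_lt ?_ (hN m hm n hn)⟩
    rw [dist_eq_norm, Real.dist_eq, ← mul_sub, abs_mul, abs_of_nonneg (by positivity)]
    exact (hrate n m z t ht).trans (by ring_nf; rfl)
  -- Evaluating at `max t 0` makes the limit the identity for negative times, so that the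
  -- contraction bound and continuity hold on the whole line.
  have hmax : ∀ t : ℝ, 0 ≤ max t 0 := fun t => le_max_right _ _
  choose e he using fun (t : ℝ) (x : X) => cauchySeq_tendsto_of_complete (hcauchy _ (hmax t) x)
  have hen : ∀ t x, ‖e t x‖ ≤ ‖x‖ := fun t x =>
    le_of_tendsto (he t x).norm (Eventually.of_forall fun n =>
      norm_exp_smul_apply_le (hLd n) (hmax t) x)
  have hadd : ∀ t x y, e t (x + y) = e t x + e t y := fun t x y =>
    tendsto_nhds_unique (he t (x + y)) (by simpa using (he t x).add (he t y))
  have hsmul : ∀ t (c : ℝ) x, e t (c • x) = c • e t x := fun t c x =>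
    tendsto_nhds_unique (he t (c • x)) (by simpa using (he t x).const_smul c)
  let E : ℝ → X →L[ℝ] X := fun t => LinearMap.mkContinuous
    { toFun := e t, map_add' := hadd t, map_smul' := hsmul t } 1
    (fun x => by simpa using hen t x)
  have hE : ∀ t x, E t x = e t x := fun _ _ => rfl
  have hcont : ∀ x, Continuous fun t => E t x := by
    intro x
    -- Orbits starting in the range of `B` are Lipschitz, uniformly in `n`. By contractivity they
    -- approximate every other orbit uniformly in time.
    refine continuous_of_uniform_approx_of_continuous fun u hu => ?_
    obtain ⟨δ, hδ, hu⟩ := Metric.mem_uniformity_dist.1 hu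
    obtain ⟨_, hy, y, rfl⟩ := Metric.dense_iff.1 hd x δ hδ
    refine ⟨fun t => E t (B y), ?_, fun t => hu ?_⟩
    · refine (LipschitzWith.of_dist_le_mul (K := ⟨2 * ‖y‖, by positivity⟩) fun t s => ?_).continuous
      rw [dist_eq_norm, Real.dist_eq, hE, hE]
      refine le_of_tendsto ((he t _).sub (he s _)).norm (Eventually.of_forall fun n => ?_)
      refine (norm_exp_smul_sub_le (hLd n) (B y) (hmax s) (hmax t)).trans ?_
      refine mul_le_mul (hLBn n y) ?_ (abs_nonneg _) (mul_nonneg zero_le_two (norm_nonneg y))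
      simpa using abs_max_sub_max_le_abs t s 0
    · rw [dist_eq_norm, ← map_sub]
      rw [Metric.mem_ball, dist_comm, dist_eq_norm] at hy
      exact (hen t _).trans_lt hy
  refine ⟨E, hen, ?_, ?_⟩
  · refine continuous_prod_of_continuous_lipschitzWith' _ 1 (fun t => ?_) hcont
    exact LipschitzWith.of_dist_le_mul fun x y => by
      rw [dist_eq_norm, dist_eq_norm, ← map_sub, NNReal.coe_one, one_mul]; exact hen t (x - y)
  · intro t ht x
    -- Since `(B - ε n) ∘ L n = 1`, the left side has derivative e^{s L n} x, which stays bounded by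
    -- ‖x‖. This form passes to the limit although `L n` itself need not converge.
    have hn : ∀ n, B (exp (t • L n) x) - ε n • exp (t • L n) x
        = B x - ε n • x + ∫ s in (0 : ℝ)..t, exp (s • L n) x := by
      intro n
      have hder : ∀ s ∈ uIcc 0 t, HasDerivAt
          (fun s : ℝ => B (exp (s • L n) x) - ε n • exp (s • L n) x) (exp (s • L n) x) s := by
        intro s _
        have h := hasDerivAt_exp_smul_apply (L n) x s
        refine ((B.hasFDerivAt.comp_hasDerivAt s h).sub (h.const_smul (ε n))).congr_deriv ?_
        rw [hBL]; exact add_sub_cancel_right _ _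
      rw [intervalIntegral.integral_eq_sub_of_hasDerivAt hder
        ((continuous_exp_smul_apply _ _).intervalIntegrable _ _)]
      simp
    have hl : Tendsto (fun n => B (exp (t • L n) x) - ε n • exp (t • L n) x) atTop
        (𝓝 (B (E t x) - (0 : ℝ) • E t x)) := by
      have h := he t x
      rw [max_eq_left ht] at h
      exact ((B.continuous.tendsto _).comp h).sub (hε0.smul h)
    have hr : Tendsto (fun n => B x - ε n • x + ∫ s in (0 : ℝ)..t, exp (s • L n) x) atTop
        (𝓝 (B x - (0 : ℝ) • x + ∫ s in (0 : ℝ)..t, E s x)) := by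
      refine (tendsto_const_nhds.sub (hε0.smul_const x)).add ?_
      refine intervalIntegral.tendsto_integral_filter_of_dominated_convergence (fun _ => ‖x‖)
        (Eventually.of_forall fun n => (continuous_exp_smul_apply _ _).aestronglyMeasurable)
        (Eventually.of_forall fun n => ae_of_all _ fun s hs => ?_)
        intervalIntegrable_const (ae_of_all _ fun s hs => ?_)
      · rw [uIoc_of_le ht] at hs
        exact norm_exp_smul_apply_le (hLd n) hs.1.le x
      · rw [uIoc_of_le ht] at hs
        have h := he s x
        rwa [max_eq_left hs.1.le] at h
    simp_rw [hn] at hl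
    simpa using tendsto_nhds_unique hl hr

end Semigroup

/-! ### Convolutions, Volterra fixed points and the inhomogeneous problem -/

section Volterra

open Filter Topology Function

/-- Fubini on the triangle 0 < r ≤ s ≤ t, then the shift s ↦ s + r. A kernel κ(s - r, r) covers both
the scalar convolution and the Duhamel integral of E(s - r) F(r). -/
theorem integral_integral_triangle {X : Type*} [NormedAddCommGroup X] [NormedSpace ℝ X]
    {κ : ℝ → ℝ → X} (hκ : Continuous (uncurry κ)) {t : ℝ} (ht : 0 ≤ t) :
    ∫ s in (0 : ℝ)..t, ∫ r in (0 : ℝ)..s, κ (s - r) r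
      = ∫ r in (0 : ℝ)..t, ∫ s in (0 : ℝ)..(t - r), κ s r := by
  set D : Set (ℝ × ℝ) := {p | p.2 ≤ p.1}
  have hD : MeasurableSet D := (isClosed_le continuous_snd continuous_fst).measurableSet
  have hk : Continuous fun p : ℝ × ℝ => κ (p.1 - p.2) p.2 :=
    hκ.comp ((continuous_fst.sub continuous_snd).prodMk continuous_snd)
  set h : ℝ → ℝ → X := fun s r => D.indicator (fun p => κ (p.1 - p.2) p.2) (s, r)
  have hint : Integrable (uncurry h) ((volume.restrict (Ioc 0 t)).prod
      (volume.restrict (Ioc 0 t))) := by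
    rw [Measure.prod_restrict]
    have h1 : IntegrableOn (fun p : ℝ × ℝ => κ (p.1 - p.2) p.2) (Icc 0 t ×ˢ Icc 0 t)
        (volume.prod volume) :=
      hk.continuousOn.integrableOn_compact (isCompact_Icc.prod isCompact_Icc)
    exact (h1.mono_set (prod_mono Ioc_subset_Icc_self Ioc_subset_Icc_self)).indicator hD
  have hl : ∀ s ∈ Ioc 0 t, ∫ r in (0 : ℝ)..s, κ (s - r) r = ∫ r in Ioc 0 t, h s r := by
    intro s hs
    have hh : h s = (Iic s).indicator fun r => κ (s - r) r := by
      ext r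
      by_cases hr : r ≤ s <;> simp [h, D, indicator, hr]
    rw [hh, setIntegral_indicator measurableSet_Iic, intervalIntegral.integral_of_le hs.1.le,
      Ioc_inter_Iic, min_eq_right hs.2]
  have hr : ∀ r ∈ Ioc 0 t, ∫ s in (0 : ℝ)..(t - r), κ s r = ∫ s in Ioc 0 t, h s r := by
    intro r hr
    have hh : (fun s => h s r) = (Ici r).indicator fun s => κ (s - r) r := by
      ext s
      by_cases hr : r ≤ s <;> simp [h, D, indicator, hr]
    have hI : Ioc 0 t ∩ Ici r = Icc r t := by
      ext s
      simp only [mem_inter_iff, mem_Ioc, mem_Ici, mem_Icc]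
      exact ⟨fun h => ⟨h.2, h.1.2⟩, fun h => ⟨⟨hr.1.trans_le h.1, h.2⟩, h.1⟩⟩
    have hsub := intervalIntegral.integral_comp_sub_right (a := r) (b := t) (fun s => κ s r) r
    rw [sub_self] at hsub
    rw [hh, setIntegral_indicator measurableSet_Ici, hI, integral_Icc_eq_integral_Ioc,
      ← intervalIntegral.integral_of_le hr.2, hsub]
  rw [intervalIntegral.integral_of_le ht, intervalIntegral.integral_of_le ht,
    setIntegral_congr_fun measurableSet_Ioc hl, setIntegral_congr_fun measurableSet_Ioc hr]
  exact integral_integral_swap hint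

section Conv

variable {X : Type*} [NormedAddCommGroup X] [NormedSpace ℝ X]

/-- The convolution `(g * f)(t) = ∫₀ᵗ g(t - s) f(s) ds`. -/
noncomputable def volterraConv (g : ℝ → ℝ) (f : ℝ → X) (t : ℝ) : X :=
  ∫ s in (0 : ℝ)..t, g (t - s) • f s

theorem continuous_volterraConv {g : ℝ → ℝ} (hg : Continuous g) {f : ℝ → X} (hf : Continuous f) :
    Continuous (volterraConv g f) :=
  intervalIntegral.continuous_parametric_intervalIntegral_of_continuous
    (f := fun t s => g (t - s) • f s)
    ((hg.comp (continuous_fst.sub continuous_snd)).smul (hf.comp continuous_snd)) continuous_id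

theorem volterraConv_comm (g : ℝ → ℝ) (f : ℝ → X) (t : ℝ) :
    volterraConv g f t = ∫ s in (0 : ℝ)..t, g s • f (t - s) := by
  have h := intervalIntegral.integral_comp_sub_left (a := 0) (b := t)
    (fun s => g s • f (t - s)) t
  simpa [volterraConv] using h

theorem integral_volterraConv {g : ℝ → ℝ} (hg : Continuous g) {f : ℝ → X} (hf : Continuous f)
    {t : ℝ} (ht : 0 ≤ t) :
    ∫ s in (0 : ℝ)..t, volterraConv g f s = volterraConv g (fun s => ∫ r in (0 : ℝ)..s, f r) t := by
  simp_rw [volterraConv_comm]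
  rw [integral_integral_triangle (κ := fun s r => g r • f s)
    ((hg.comp continuous_snd).smul (hf.comp continuous_fst)) ht]
  simp_rw [intervalIntegral.integral_smul]

theorem volterraConv_const (g : ℝ → ℝ) (x : X) (t : ℝ) :
    volterraConv g (fun _ => x) t = ∫ s in (0 : ℝ)..t, g s • x := by
  rw [volterraConv_comm]

theorem volterraConv_add {g : ℝ → ℝ} (hg : Continuous g) {f₁ f₂ : ℝ → X} (h₁ : Continuous f₁)
    (h₂ : Continuous f₂) (t : ℝ) : volterraConv g (fun s => f₁ s + f₂ s) t
      = volterraConv g f₁ t + volterraConv g f₂ t := by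
  simp only [volterraConv, smul_add]
  have : Continuous fun s => g (t - s) := by fun_prop
  exact intervalIntegral.integral_add ((this.smul h₁).intervalIntegrable _ _)
    ((this.smul h₂).intervalIntegrable _ _)

theorem volterraConv_sub {g : ℝ → ℝ} (hg : Continuous g) {f₁ f₂ : ℝ → X} (h₁ : Continuous f₁)
    (h₂ : Continuous f₂) (t : ℝ) : volterraConv g (fun s => f₁ s - f₂ s) t
      = volterraConv g f₁ t - volterraConv g f₂ t := by
  simp only [volterraConv, smul_sub]
  have : Continuous fun s => g (t - s) := by fun_prop
  exact intervalIntegral.integral_sub ((this.smul h₁).intervalIntegrable _ _)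
    ((this.smul h₂).intervalIntegrable _ _)

theorem norm_integral_le_integral_norm_of_nonneg (f : ℝ → X) {t : ℝ} (ht : 0 ≤ t) :
    ‖∫ s in (0 : ℝ)..t, f s‖ ≤ ∫ s in (0 : ℝ)..t, ‖f s‖ :=
  intervalIntegral.norm_integral_le_integral_norm ht

theorem continuous_primitive_of_continuous {f : ℝ → X} (hf : Continuous f) :
    Continuous fun t => ∫ s in (0 : ℝ)..t, f s :=
  intervalIntegral.continuous_primitive (fun _ _ => hf.intervalIntegrable _ _) 0

theorem integral_mono_right_of_nonneg {f : ℝ → ℝ} (hf : Continuous f) (h0 : ∀ t, 0 ≤ f t)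
    {s t : ℝ} (hst : s ≤ t) : ∫ r in (0 : ℝ)..s, f r ≤ ∫ r in (0 : ℝ)..t, f r := by
  rw [← intervalIntegral.integral_add_adjacent_intervals (hf.intervalIntegrable 0 s)
    (hf.intervalIntegrable s t)]
  exact le_add_of_nonneg_right (intervalIntegral.integral_nonneg hst fun r _ => h0 r)

end Conv

/-- Fixed points of causal maps on `C([0, ∞); X)` that are Lipschitz in the Volterra sense. -/
theorem exists_volterra_fixedPoint {X : Type*} [NormedAddCommGroup X] [NormedSpace ℝ X]
    [CompleteSpace X] (Φ : (ℝ → X) → ℝ → X) (hΦc : ∀ U, Continuous U → Continuous (Φ U)) {C D : ℝ}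
    (hC : 0 < C) (hΦ : ∀ U V, Continuous U → Continuous V → ∀ t, 0 ≤ t →
      ‖Φ U t - Φ V t‖ ≤ C * ∫ s in (0 : ℝ)..t, ‖U s - V s‖)
    (h0 : ∀ t, 0 ≤ t → ‖Φ (fun _ => 0) t‖ ≤ D * (1 + t)) :
    ∃ U, Continuous U ∧ ∀ t, 0 ≤ t → U t = Φ U t := by
  -- With the weight e^{μt} the Volterra bound becomes C ∫₀ᵗ e^{μs} ds ≤ e^{μt} / 2. So the map
  -- induced on W = e^{-μt} U is a 1/2-contraction of bounded continuous functions.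
  set μ : ℝ := 2 * C
  have hμ : 0 < μ := by positivity
  have hD : 0 ≤ D := by simpa using (norm_nonneg _).trans (h0 0 le_rfl)
  have hint : ∀ t, C * ∫ s in (0 : ℝ)..t, Real.exp (μ * s) = (Real.exp (μ * t) - 1) / 2 := by
    intro t
    have hder : ∀ s ∈ uIcc 0 t, HasDerivAt (fun s => Real.exp (μ * s) / μ) (Real.exp (μ * s)) s := by
      intro s _
      refine ((((hasDerivAt_id s).const_mul μ).exp).div_const μ).congr_deriv ?_
      simp [hμ.ne']
    rw [intervalIntegral.integral_eq_sub_of_hasDerivAt hder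
      ((by fun_prop : Continuous fun s => Real.exp (μ * s)).intervalIntegrable _ _)]
    simp only [μ, mul_zero, Real.exp_zero]
    field_simp
  have hneg : ∀ t, Real.exp (-(μ * t)) * Real.exp (μ * t) = 1 := fun t => by
    rw [← Real.exp_add]; simp
  let u : BoundedContinuousFunction ℝ X → ℝ → X := fun W s => Real.exp (μ * s) • W s
  have hu : ∀ W, Continuous (u W) := fun W =>
    (by fun_prop : Continuous fun s => Real.exp (μ * s)).smul W.continuous
  have hlip : ∀ W W' t, 0 ≤ t →
      ‖Real.exp (-(μ * t)) • (Φ (u W) t - Φ (u W') t)‖ ≤ 1 / 2 * ‖W - W'‖ := by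
    intro W W' t ht
    have hle : ∫ s in (0 : ℝ)..t, ‖u W s - u W' s‖
        ≤ ∫ s in (0 : ℝ)..t, Real.exp (μ * s) * ‖W - W'‖ := by
      refine intervalIntegral.integral_mono_on ht (((hu W).sub (hu W')).norm.intervalIntegrable _ _)
        ((by fun_prop : Continuous fun s => Real.exp (μ * s) * ‖W - W'‖).intervalIntegrable _ _)
        fun s _ => ?_
      simp only [u]
      rw [← smul_sub, norm_smul, Real.norm_of_nonneg (Real.exp_pos _).le]
      exact mul_le_mul_of_nonneg_left ((W - W').norm_coe_le_norm s) (Real.exp_pos _).le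
    rw [intervalIntegral.integral_mul_const] at hle
    rw [norm_smul, Real.norm_of_nonneg (Real.exp_pos _).le]
    calc Real.exp (-(μ * t)) * ‖Φ (u W) t - Φ (u W') t‖
        ≤ Real.exp (-(μ * t)) * (C * ((∫ s in (0 : ℝ)..t, Real.exp (μ * s)) * ‖W - W'‖)) :=
          mul_le_mul_of_nonneg_left ((hΦ _ _ (hu W) (hu W') t ht).trans
            (mul_le_mul_of_nonneg_left hle hC.le)) (Real.exp_pos _).le
      _ = (1 - Real.exp (-(μ * t))) / 2 * ‖W - W'‖ := by
          rw [← mul_assoc C, hint]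
          linear_combination (‖W - W'‖ / 2) * hneg t
      _ ≤ 1 / 2 * ‖W - W'‖ := by
          refine mul_le_mul_of_nonneg_right ?_ (norm_nonneg _)
          linarith [Real.exp_pos (-(μ * t))]
  have hu0 : u 0 = fun _ => 0 := by ext s; simp [u]
  have hbound : ∀ W t, 0 ≤ t →
      ‖Real.exp (-(μ * t)) • Φ (u W) t‖ ≤ 1 / 2 * ‖W‖ + D * (1 + 1 / μ) := by
    intro W t ht
    have h1 := hlip W 0 t ht
    have h2 : ‖Real.exp (-(μ * t)) • Φ (u 0) t‖ ≤ D * (1 + 1 / μ) := by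
      rw [norm_smul, Real.norm_of_nonneg (Real.exp_pos _).le, hu0]
      -- The weight absorbs the linear growth allowed in `h0`, so the weighted map sends bounded
      -- functions to bounded functions.
      have h3 : Real.exp (-(μ * t)) * t ≤ 1 / μ := by
        rw [le_div_iff₀ hμ]
        have h4 := mul_le_mul_of_nonneg_left
          ((le_add_of_nonneg_right zero_le_one).trans (Real.add_one_le_exp (μ * t)))
          (Real.exp_pos (-(μ * t))).le
        rw [hneg] at h4
        linarith
      have h5 : Real.exp (-(μ * t)) ≤ 1 := Real.exp_le_one_iff.2 (by nlinarith)
      calc Real.exp (-(μ * t)) * ‖Φ (fun _ => 0) t‖ ≤ Real.exp (-(μ * t)) * (D * (1 + t)) :=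
            mul_le_mul_of_nonneg_left (h0 t ht) (Real.exp_pos _).le
        _ = D * (Real.exp (-(μ * t)) + Real.exp (-(μ * t)) * t) := by ring
        _ ≤ D * (1 + 1 / μ) := mul_le_mul_of_nonneg_left (add_le_add h5 h3) hD
    rw [sub_zero, smul_sub] at h1
    have h6 := norm_add_le (Real.exp (-(μ * t)) • Φ (u W) t - Real.exp (-(μ * t)) • Φ (u 0) t)
      (Real.exp (-(μ * t)) • Φ (u 0) t)
    rw [sub_add_cancel] at h6
    linarith
  have hmax : ∀ t : ℝ, 0 ≤ max t 0 := fun t => le_max_right _ _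
  let Ψ : BoundedContinuousFunction ℝ X → BoundedContinuousFunction ℝ X := fun W =>
    BoundedContinuousFunction.ofNormedAddCommGroup
      (fun t => Real.exp (-(μ * max t 0)) • Φ (u W) (max t 0))
      ((by fun_prop : Continuous fun t : ℝ => Real.exp (-(μ * max t 0))).smul
        ((hΦc _ (hu W)).comp (continuous_id.max continuous_const)))
      (1 / 2 * ‖W‖ + D * (1 + 1 / μ)) (fun t => hbound W _ (hmax t))
  have hΨ : ∀ W t, Ψ W t = Real.exp (-(μ * max t 0)) • Φ (u W) (max t 0) := fun _ _ => rfl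
  have hcontr : ContractingWith (1 / 2) Ψ := by
    refine ⟨by norm_num, LipschitzWith.of_dist_le_mul fun W W' => ?_⟩
    rw [BoundedContinuousFunction.dist_le (by positivity)]
    intro t
    rw [hΨ, hΨ, dist_eq_norm, dist_eq_norm, ← smul_sub]
    simpa using hlip W W' _ (hmax t)
  have hfix : Ψ hcontr.fixedPoint = hcontr.fixedPoint := hcontr.fixedPoint_isFixedPt
  refine ⟨u hcontr.fixedPoint, hu _, fun t ht => ?_⟩
  have h := hΨ hcontr.fixedPoint t
  rw [hfix, max_eq_left ht] at h
  simp only [u] at h ⊢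
  nth_rewrite 1 [h]
  rw [smul_smul, mul_comm, hneg, one_smul]

/-- Grönwall's inequality for the primitive of ‖f‖, which vanishes at 0 and whose derivative is at
most `C` times itself. -/
theorem eq_zero_of_norm_le_integral {X : Type*} [NormedAddCommGroup X] {f : ℝ → X}
    (hf : Continuous f) {C : ℝ} (h : ∀ t, 0 ≤ t → ‖f t‖ ≤ C * ∫ s in (0 : ℝ)..t, ‖f s‖)
    {t : ℝ} (ht : 0 ≤ t) : f t = 0 := by
  have hd : ∀ s, HasDerivAt (fun s => ∫ r in (0 : ℝ)..s, ‖f r‖) ‖f s‖ s := fun s =>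
    intervalIntegral.integral_hasDerivAt_right (hf.norm.intervalIntegrable _ _)
      (hf.norm.stronglyMeasurableAtFilter _ _) hf.norm.continuousAt
  have hg := norm_le_gronwallBound_of_norm_deriv_right_le (a := 0) (b := t) (δ := 0) (ε := 0)
    (K := C) (continuous_primitive_of_continuous hf.norm).continuousOn
    (fun s _ => (hd s).hasDerivWithinAt) (by simp) (fun s hs => by
      have h0 : 0 ≤ ∫ r in (0 : ℝ)..s, ‖f r‖ :=
        intervalIntegral.integral_nonneg hs.1 fun _ _ => norm_nonneg _
      rw [norm_norm, add_zero, Real.norm_of_nonneg h0]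
      exact h s hs.1) t ⟨ht, le_rfl⟩
  rw [gronwallBound_ε0, zero_mul, norm_le_zero_iff] at hg
  have := h t ht
  rw [hg, mul_zero, norm_le_zero_iff] at this
  exact this

/-- Well-posedness of the inhomogeneous problem `U' = B⁻¹ U + F`, `U(0) = U₀`, in the integrated
form `B U = B U₀ + ∫ U + B ∫ F`, for a bounded skew-symmetric `B`. -/
theorem exists_solution_operator_of_skew {X : Type*} [NormedAddCommGroup X]
    [InnerProductSpace ℝ X] [CompleteSpace X] (B : X →L[ℝ] X) (hB : ∀ x, inner ℝ (B x) x = 0)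
    (hd : DenseRange B) : ∃ S : X → (ℝ → X) → ℝ → X,
      (∀ U₀ F, Continuous F → Continuous (S U₀ F) ∧ ∀ t, 0 ≤ t → B (S U₀ F t)
        = B U₀ + (∫ s in (0 : ℝ)..t, S U₀ F s) + B (∫ s in (0 : ℝ)..t, F s)) ∧
      (∀ U₀ F, Continuous F → ∀ t, 0 ≤ t → ‖S U₀ F t‖ ≤ ‖U₀‖ + ∫ s in (0 : ℝ)..t, ‖F s‖) ∧
      (∀ U₀ F G, Continuous F → Continuous G → ∀ t, 0 ≤ t →
        ‖S U₀ F t - S U₀ G t‖ ≤ ∫ s in (0 : ℝ)..t, ‖F s - G s‖) ∧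
      (∀ U₀ F U, Continuous F → Continuous U → (∀ t, 0 ≤ t → B (U t)
        = B U₀ + (∫ s in (0 : ℝ)..t, U s) + B (∫ s in (0 : ℝ)..t, F s)) →
        ∀ t, 0 ≤ t → U t = S U₀ F t) := by
  obtain ⟨E, hE, hEc, hBE⟩ := exists_semigroup_of_skew B hB hd
  have hskew : ∀ x y, inner ℝ (B x) y = - inner ℝ x (B y) := by
    intro x y
    have h := hB (x + y)
    simp only [map_add, inner_add_left, inner_add_right, hB] at h
    rw [real_inner_comm x (B y)] at h
    linarith
  -- By skewness the kernel of `B` is orthogonal to its dense range.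
  have hinj : ∀ x, B x = 0 → x = 0 := by
    intro x hx
    have h : ∀ y, inner ℝ x y = 0 := fun y => by
      refine hd.induction (P := fun y => inner ℝ x y = 0) ?_ ?_ y
      · rintro _ ⟨z, rfl⟩
        have := hskew x z
        rw [hx, inner_zero_left] at this
        linarith
      · exact isClosed_eq (continuous_const.inner continuous_id) continuous_const
    exact inner_self_eq_zero.1 (h x)
  -- For Y = ∫ U the hypothesis says B Y' = Y, so (‖Y‖²)' = 2⟨B Y', Y'⟩ = 0. Thus Y = 0, and then B
  -- U = 0.
  have huniq : ∀ U : ℝ → X, Continuous U → (∀ t, 0 ≤ t → B (U t) = ∫ s in (0 : ℝ)..t, U s) →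
      ∀ t, 0 ≤ t → U t = 0 := by
    intro U hU h t ht
    have hY : ∀ s, HasDerivAt (fun s => ∫ r in (0 : ℝ)..s, U r) (U s) s := fun s =>
      intervalIntegral.integral_hasDerivAt_right (hU.intervalIntegrable _ _)
        (hU.stronglyMeasurableAtFilter _ _) hU.continuousAt
    have h1 := constant_of_has_deriv_right_zero (a := 0) (b := t)
      (f := fun s => ‖∫ r in (0 : ℝ)..s, U r‖ ^ 2)
      ((continuous_primitive_of_continuous hU).norm.pow 2).continuousOn (fun s hs => by
        have h2 := ((hY s).norm_sq).hasDerivWithinAt (s := Ici s)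
        rwa [← h s hs.1, hB, mul_zero] at h2) t ⟨ht, le_rfl⟩
    have h2 : ∫ r in (0 : ℝ)..t, U r = 0 := by simpa using h1
    exact hinj _ ((h t ht).trans h2)
  have hker : ∀ F : ℝ → X, Continuous F → Continuous fun p : ℝ × ℝ => E (p.1 - p.2) (F p.2) :=
    fun F hF => hEc.comp ((continuous_fst.sub continuous_snd).prodMk (hF.comp continuous_snd))
  have hker' : ∀ F : ℝ → X, Continuous F → ∀ t, Continuous fun s : ℝ => E (t - s) (F s) :=
    fun F hF t => (hker F hF).comp (continuous_const.prodMk continuous_id)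
  have hEx : ∀ x, Continuous fun t => E t x := fun x =>
    hEc.comp (continuous_id.prodMk continuous_const)
  have hSc : ∀ U₀ F, Continuous F →
      Continuous fun t => E t U₀ + ∫ s in (0 : ℝ)..t, E (t - s) (F s) := fun U₀ F hF =>
    (hEx U₀).add (intervalIntegral.continuous_parametric_intervalIntegral_of_continuous
      (f := fun t s => E (t - s) (F s)) (hker F hF) continuous_id)
  have hDle : ∀ F : ℝ → X, Continuous F → ∀ t, 0 ≤ t →
      ‖∫ s in (0 : ℝ)..t, E (t - s) (F s)‖ ≤ ∫ s in (0 : ℝ)..t, ‖F s‖ := fun F hF t ht =>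
    intervalIntegral.norm_integral_le_of_norm_le ht (ae_of_all _ fun s _ => hE _ _)
      (hF.norm.intervalIntegrable _ _)
  have hS : ∀ U₀ F, Continuous F → ∀ t, 0 ≤ t →
      B (E t U₀ + ∫ s in (0 : ℝ)..t, E (t - s) (F s))
        = B U₀ + (∫ s in (0 : ℝ)..t, (E s U₀ + ∫ r in (0 : ℝ)..s, E (s - r) (F r)))
          + B (∫ s in (0 : ℝ)..t, F s) := by
    intro U₀ F hF t ht
    have hDc : Continuous fun t => ∫ s in (0 : ℝ)..t, E (t - s) (F s) :=
      intervalIntegral.continuous_parametric_intervalIntegral_of_continuous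
        (f := fun t s => E (t - s) (F s)) (hker F hF) continuous_id
    have hJc : Continuous fun s => ∫ r in (0 : ℝ)..(t - s), E r (F s) :=
      intervalIntegral.continuous_parametric_intervalIntegral_of_continuous
        (f := fun s r => E r (F s))
        (hEc.comp (continuous_snd.prodMk (hF.comp continuous_fst)))
        (continuous_const.sub continuous_id)
    have hBF : Continuous fun s => B (F s) := B.continuous.comp hF
    -- The orbit identity for `E` at time t - s turns `B` of the Duhamel integral into B ∫ F plus a
    -- double integral over a triangle, which is the time integral of the Duhamel term.
    have hcongr : ∫ s in (0 : ℝ)..t, B (E (t - s) (F s))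
        = ∫ s in (0 : ℝ)..t, (B (F s) + ∫ r in (0 : ℝ)..(t - s), E r (F s)) := by
      refine intervalIntegral.integral_congr fun s hs => ?_
      rw [uIcc_of_le ht] at hs
      exact hBE _ (sub_nonneg.2 hs.2) _
    rw [map_add, hBE t ht, ← B.intervalIntegral_comp_comm ((hker' F hF t).intervalIntegrable _ _),
      hcongr, intervalIntegral.integral_add (hBF.intervalIntegrable _ _)
        (hJc.intervalIntegrable _ _), B.intervalIntegral_comp_comm (hF.intervalIntegrable _ _),
      intervalIntegral.integral_add ((hEx U₀).intervalIntegrable _ _) (hDc.intervalIntegrable _ _),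
      integral_integral_triangle (κ := fun s r => E s (F r))
        (hEc.comp (continuous_fst.prodMk (hF.comp continuous_snd))) ht]
    abel
  refine ⟨fun U₀ F t => E t U₀ + ∫ s in (0 : ℝ)..t, E (t - s) (F s),
    fun U₀ F hF => ⟨hSc U₀ F hF, hS U₀ F hF⟩, fun U₀ F hF t ht => ?_,
    fun U₀ F G hF hG t ht => ?_, fun U₀ F U hF hU h t ht => ?_⟩
  · exact (norm_add_le _ _).trans (add_le_add (hE _ _) (hDle F hF t ht))
  · rw [add_sub_add_left_eq_sub, ← intervalIntegral.integral_sub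
      ((hker' F hF t).intervalIntegrable _ _) ((hker' G hG t).intervalIntegrable _ _)]
    simp_rw [← map_sub]
    exact hDle (fun s => F s - G s) (hF.sub hG) t ht
  · refine sub_eq_zero.1 (huniq (fun t => U t - (E t U₀ + ∫ s in (0 : ℝ)..t, E (t - s) (F s)))
      (hU.sub (hSc U₀ F hF)) (fun t ht => ?_) t ht)
    rw [map_sub, h t ht, hS U₀ F hF t ht, intervalIntegral.integral_sub
      (hU.intervalIntegrable _ _) ((hSc U₀ F hF).intervalIntegrable _ _)]
    abel

end Volterra

/-! ### The first-order system with memory -/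

section MemorySystem

open Filter Topology Function

variable {H : Type*} [NormedAddCommGroup H] [InnerProductSpace ℝ H]

theorem norm_volterraConv_le_of_bound {g : ℝ → ℝ} (hg : Continuous g) {M : ℝ}
    (hM : ∀ t, 0 ≤ t → ∫ s in (0 : ℝ)..t, ‖g s‖ ≤ M) {f : ℝ → H} {t N : ℝ} (ht : 0 ≤ t)
    (hN0 : 0 ≤ N) (hN : ∀ s ∈ Icc 0 t, ‖f s‖ ≤ N) : ‖volterraConv g f t‖ ≤ M * N := by
  rw [volterraConv_comm]
  refine le_trans ?_ (mul_le_mul_of_nonneg_right (hM t ht) hN0)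
  rw [← intervalIntegral.integral_mul_const]
  refine intervalIntegral.norm_integral_le_of_norm_le ht (ae_of_all _ fun s hs => ?_)
    ((hg.norm.mul continuous_const).intervalIntegrable _ _)
  rw [norm_smul]
  exact mul_le_mul_of_nonneg_left (hN _ ⟨sub_nonneg.2 hs.2, by linarith [hs.1]⟩) (norm_nonneg _)

/-- Young's inequality in L¹(0, t): integrating the convolution of the norms gives ‖g‖ * ∫ ‖f‖, and
the primitive of ‖f‖ is largest at t. -/
theorem integral_norm_volterraConv_le {g : ℝ → ℝ} (hg : Continuous g) {M : ℝ}
    (hM : ∀ t, 0 ≤ t → ∫ s in (0 : ℝ)..t, ‖g s‖ ≤ M) {f : ℝ → H} (hf : Continuous f) {t : ℝ}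
    (ht : 0 ≤ t) :
    ∫ s in (0 : ℝ)..t, ‖volterraConv g f s‖ ≤ M * ∫ s in (0 : ℝ)..t, ‖f s‖ := by
  have h1 : ∫ s in (0 : ℝ)..t, ‖volterraConv g f s‖
      ≤ ∫ s in (0 : ℝ)..t, volterraConv (fun s => ‖g s‖) (fun s => ‖f s‖) s := by
    refine intervalIntegral.integral_mono_on ht
      ((continuous_volterraConv hg hf).norm.intervalIntegrable _ _)
      ((continuous_volterraConv hg.norm hf.norm).intervalIntegrable _ _) fun s hs => ?_
    refine (norm_integral_le_integral_norm_of_nonneg _ hs.1).trans_eq ?_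
    simp only [volterraConv, norm_smul, smul_eq_mul]
  refine h1.trans ?_
  rw [integral_volterraConv hg.norm hf.norm ht]
  refine (Real.le_norm_self _).trans (norm_volterraConv_le_of_bound hg.norm (by simpa using hM) ht
    (intervalIntegral.integral_nonneg ht fun _ _ => norm_nonneg _) fun s hs => ?_)
  rw [Real.norm_of_nonneg (intervalIntegral.integral_nonneg hs.1 fun _ _ => norm_nonneg _)]
  exact integral_mono_right_of_nonneg hf.norm (fun _ => norm_nonneg _) hs.2

/-- The stress `c² P - g * P` of the displacement `P(t) = P₀ + ∫₀ᵗ p`. -/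
noncomputable def memoryStress (c : ℝ) (g : ℝ → ℝ) (P₀ : H) (p : ℝ → H) (t : ℝ) : H :=
  c ^ 2 • (P₀ + ∫ s in (0 : ℝ)..t, p s)
    - volterraConv g (fun s => P₀ + ∫ r in (0 : ℝ)..s, p r) t

/-- The time derivative of `memoryStress`. -/
noncomputable def memoryStressRate (c : ℝ) (g : ℝ → ℝ) (P₀ : H) (p : ℝ → H) (t : ℝ) : H :=
  c ^ 2 • p t - g t • P₀ - volterraConv g p t

section

variable {c : ℝ} {g : ℝ → ℝ} (hg : Continuous g)

include hg

theorem continuous_memoryStress (P₀ : H) {p : ℝ → H} (hp : Continuous p) :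
    Continuous (memoryStress c g P₀ p) := by
  have h : Continuous fun s => P₀ + ∫ r in (0 : ℝ)..s, p r :=
    continuous_const.add (continuous_primitive_of_continuous hp)
  exact (h.const_smul (c ^ 2)).sub (continuous_volterraConv hg h)

theorem continuous_memoryStressRate (P₀ : H) {p : ℝ → H} (hp : Continuous p) :
    Continuous (memoryStressRate c g P₀ p) :=
  ((hp.const_smul (c ^ 2)).sub (hg.smul continuous_const)).sub (continuous_volterraConv hg hp)

/-- The time derivative falls on the displacement and not on the kernel, so continuity of `g`
suffices. The term g(t) P₀ comes from the convolution with the constant P₀. -/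
theorem integral_memoryStressRate (P₀ : H) {p : ℝ → H} (hp : Continuous p) {t : ℝ} (ht : 0 ≤ t) :
    ∫ s in (0 : ℝ)..t, memoryStressRate c g P₀ p s = memoryStress c g P₀ p t - c ^ 2 • P₀ := by
  have h1 : Continuous fun s => g s • P₀ := hg.smul continuous_const
  have h2 : Continuous fun s => c ^ 2 • p s := hp.const_smul (c ^ 2)
  have h3 : Continuous fun s => c ^ 2 • p s - g s • P₀ := h2.sub h1
  simp only [memoryStressRate, memoryStress]
  rw [intervalIntegral.integral_sub (h3.intervalIntegrable _ _)
    ((continuous_volterraConv hg hp).intervalIntegrable _ _),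
    intervalIntegral.integral_sub (h2.intervalIntegrable _ _) (h1.intervalIntegrable _ _),
    intervalIntegral.integral_smul, integral_volterraConv hg hp ht,
    volterraConv_add hg continuous_const (continuous_primitive_of_continuous hp),
    volterraConv_const]
  module

theorem memoryStress_sub (P₀ P₁ : H) {p q : ℝ → H} (hp : Continuous p) (hq : Continuous q)
    (t : ℝ) : memoryStress c g P₀ p t - memoryStress c g P₁ q t
      = memoryStress c g (P₀ - P₁) (fun s => p s - q s) t := by
  have h : ∀ s, P₀ - P₁ + ∫ r in (0 : ℝ)..s, (p r - q r)
      = (P₀ + ∫ r in (0 : ℝ)..s, p r) - (P₁ + ∫ r in (0 : ℝ)..s, q r) := by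
    intro s
    rw [intervalIntegral.integral_sub (hp.intervalIntegrable _ _) (hq.intervalIntegrable _ _)]
    abel
  have hc : ∀ (x : H) {f : ℝ → H}, Continuous f → Continuous fun s => x + ∫ r in (0 : ℝ)..s, f r :=
    fun x _ hf => continuous_const.add (continuous_primitive_of_continuous hf)
  simp only [memoryStress, h]
  rw [volterraConv_sub hg (hc P₀ hp) (hc P₁ hq)]
  module

theorem memoryStressRate_sub (P₀ : H) {p q : ℝ → H} (hp : Continuous p) (hq : Continuous q)
    (t : ℝ) : memoryStressRate c g P₀ p t - memoryStressRate c g P₀ q t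
      = memoryStressRate c g 0 (fun s => p s - q s) t := by
  simp only [memoryStressRate]
  rw [volterraConv_sub hg hp hq]
  module

variable {M : ℝ} (hM : ∀ t, 0 ≤ t → ∫ s in (0 : ℝ)..t, ‖g s‖ ≤ M)

include hM

/-- The stress at time t sees `p` only through its integral. This makes the recovery of `p` from the
total stress a Volterra equation. -/
theorem norm_memoryStress_le (P₀ : H) {p : ℝ → H} (hp : Continuous p) {t : ℝ} (ht : 0 ≤ t) :
    ‖memoryStress c g P₀ p t‖ ≤ (c ^ 2 + M) * (‖P₀‖ + ∫ s in (0 : ℝ)..t, ‖p s‖) := by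
  have hle : ∀ s ∈ Icc 0 t, ‖P₀ + ∫ r in (0 : ℝ)..s, p r‖ ≤ ‖P₀‖ + ∫ s in (0 : ℝ)..t, ‖p s‖ :=
    fun s hs => (norm_add_le _ _).trans (add_le_add_right
      ((norm_integral_le_integral_norm_of_nonneg _ hs.1).trans
        (integral_mono_right_of_nonneg hp.norm (fun _ => norm_nonneg _) hs.2)) _)
  have h0 := (norm_nonneg _).trans (hle t ⟨ht, le_rfl⟩)
  rw [add_mul]
  refine (norm_sub_le _ _).trans (add_le_add ?_ (norm_volterraConv_le_of_bound hg hM ht h0 hle))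
  rw [norm_smul, Real.norm_of_nonneg (sq_nonneg c)]
  exact mul_le_mul_of_nonneg_left (hle t ⟨ht, le_rfl⟩) (sq_nonneg c)

theorem integral_norm_memoryStressRate_le (P₀ : H) {p : ℝ → H} (hp : Continuous p) {t : ℝ}
    (ht : 0 ≤ t) : ∫ s in (0 : ℝ)..t, ‖memoryStressRate c g P₀ p s‖
      ≤ (c ^ 2 + M) * (∫ s in (0 : ℝ)..t, ‖p s‖) + M * ‖P₀‖ := by
  have i1 : IntervalIntegrable (fun s => c ^ 2 * ‖p s‖) volume 0 t :=
    (continuous_const.mul hp.norm).intervalIntegrable _ _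
  have i2 : IntervalIntegrable (fun s => ‖g s‖ * ‖P₀‖) volume 0 t :=
    (hg.norm.mul continuous_const).intervalIntegrable _ _
  have i3 := (continuous_volterraConv hg hp).norm.intervalIntegrable (μ := volume) 0 t
  calc ∫ s in (0 : ℝ)..t, ‖memoryStressRate c g P₀ p s‖
      ≤ ∫ s in (0 : ℝ)..t, (c ^ 2 * ‖p s‖ + ‖g s‖ * ‖P₀‖ + ‖volterraConv g p s‖) := by
        refine intervalIntegral.integral_mono_on ht
          ((continuous_memoryStressRate hg P₀ hp).norm.intervalIntegrable _ _)
          ((i1.add i2).add i3) fun s _ => ?_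
        refine (norm_sub_le _ _).trans (add_le_add_left ((norm_sub_le _ _).trans_eq ?_) _)
        rw [norm_smul, norm_smul, Real.norm_of_nonneg (sq_nonneg c)]
    _ = c ^ 2 * (∫ s in (0 : ℝ)..t, ‖p s‖) + (∫ s in (0 : ℝ)..t, ‖g s‖) * ‖P₀‖
          + ∫ s in (0 : ℝ)..t, ‖volterraConv g p s‖ := by
        rw [intervalIntegral.integral_add (i1.add i2) i3, intervalIntegral.integral_add i1 i2,
          intervalIntegral.integral_const_mul, intervalIntegral.integral_mul_const]
    _ ≤ _ := by
        have h1 := integral_norm_volterraConv_le hg hM hp ht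
        have h2 := mul_le_mul_of_nonneg_right (hM t ht) (norm_nonneg P₀)
        linarith

end

omit [InnerProductSpace ℝ H] in
theorem norm_toLp_le (x y : H) : ‖WithLp.toLp 2 (x, y)‖ ≤ ‖x‖ + ‖y‖ := by
  have h : WithLp.toLp 2 (x, y) = WithLp.toLp 2 (x, (0 : H)) + WithLp.toLp 2 ((0 : H), y) := by
    rw [← WithLp.toLp_add]; simp
  rw [h]
  exact (norm_add_le _ _).trans (by rw [WithLp.norm_toLp_fst, WithLp.norm_toLp_snd])

theorem fst_intervalIntegral [CompleteSpace H] {f : ℝ → WithLp 2 (H × H)} (hf : Continuous f) (t : ℝ) :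
    (∫ s in (0 : ℝ)..t, f s).fst = ∫ s in (0 : ℝ)..t, (f s).fst :=
  ((WithLp.fstL 2 ℝ H H).intervalIntegral_comp_comm (hf.intervalIntegrable _ _)).symm

theorem snd_intervalIntegral [CompleteSpace H] {f : ℝ → WithLp 2 (H × H)} (hf : Continuous f) (t : ℝ) :
    (∫ s in (0 : ℝ)..t, f s).snd = ∫ s in (0 : ℝ)..t, (f s).snd :=
  ((WithLp.sndL 2 ℝ H H).intervalIntegral_comp_comm (hf.intervalIntegrable _ _)).symm

/-- For a bounded self-adjoint `T` with dense range, `(x, y) ↦ k (-T y, T x)` is the inverse of the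
generator of the abstract wave equation. -/
theorem exists_wave_operator (T : H →L[ℝ] H) (hT : ∀ x y, inner ℝ (T x) y = inner ℝ x (T y))
    (hTd : DenseRange T) {k : ℝ} (hk : k ≠ 0) :
    ∃ B : WithLp 2 (H × H) →L[ℝ] WithLp 2 (H × H),
      (∀ x, (B x).fst = -(k • T x.snd)) ∧ (∀ x, (B x).snd = k • T x.fst) ∧
      (∀ x, inner ℝ (B x) x = 0) ∧ DenseRange B := by
  let B : WithLp 2 (H × H) →L[ℝ] WithLp 2 (H × H) :=
    (WithLp.prodContinuousLinearEquiv 2 ℝ H H).symm.toContinuousLinearMap ∘L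
      ((-(k • T ∘L WithLp.sndL 2 ℝ H H)).prod (k • T ∘L WithLp.fstL 2 ℝ H H))
  have h1 : ∀ x, (B x).fst = -(k • T x.snd) := fun _ => rfl
  have h2 : ∀ x, (B x).snd = k • T x.fst := fun _ => rfl
  refine ⟨B, h1, h2, fun x => ?_, ?_⟩
  · rw [WithLp.prod_inner_apply, WithLp.ofLp_fst, WithLp.ofLp_snd, WithLp.ofLp_fst,
      WithLp.ofLp_snd, h1, h2, inner_neg_left, inner_smul_left, inner_smul_left, hT,
      real_inner_comm]
    simp
  · let G : H × H → WithLp 2 (H × H) := fun z => WithLp.toLp 2 (-(k • z.2), k • z.1)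
    have hG : Surjective G := fun x => ⟨(k⁻¹ • x.snd, -(k⁻¹ • x.fst)), by
      simp only [G, smul_neg, neg_neg, smul_smul, mul_inv_cancel₀ hk, one_smul]; rfl⟩
    have hGc : Continuous G := by fun_prop
    have hB : ⇑B = G ∘ Prod.map T T ∘ WithLp.ofLp := rfl
    rw [hB]
    exact hG.denseRange.comp ((hTd.prodMap hTd).comp (WithLp.ofLp_surjective 2).denseRange
      (T.continuous.prodMap T.continuous)) hGc

/-- Well-posedness of the system `p = (T⁻¹ v)`, `q = v'` obtained from
`τ v'' + α v' + T⁻²(b v + c² u - g * u) = 0`, `u' = v`, in integrated form. -/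
theorem memory_system_wellPosed [CompleteSpace H] (T : H →L[ℝ] H)
    (hT : ∀ x y, inner ℝ (T x) y = inner ℝ x (T y)) (hTd : DenseRange T) {τ b : ℝ} (hτ : 0 < τ)
    (hb : 0 < b) (α c : ℝ) {g : ℝ → ℝ} (hg : Continuous g) {M : ℝ}
    (hM : ∀ t, 0 ≤ t → ∫ s in (0 : ℝ)..t, ‖g s‖ ≤ M) :
    (∀ P₀ p₀ q₀ : H, ∃ p q : ℝ → H, Continuous p ∧ Continuous q ∧ p 0 = p₀ ∧ q 0 = q₀ ∧
      ∀ t, 0 ≤ t → T (p t) = T p₀ + ∫ s in (0 : ℝ)..t, q s ∧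
        τ • T (q t) + α • T (∫ s in (0 : ℝ)..t, q s)
          + ∫ s in (0 : ℝ)..t, (b • p s + memoryStress c g P₀ p s) = τ • T q₀) ∧
    (∀ p q : ℝ → H, Continuous p → Continuous q → (∀ t, 0 ≤ t → T (p t) = ∫ s in (0 : ℝ)..t, q s) →
      (∀ t, 0 ≤ t → τ • T (q t) + α • T (∫ s in (0 : ℝ)..t, q s)
          + ∫ s in (0 : ℝ)..t, (b • p s + memoryStress c g 0 p s) = 0) →
      ∀ t, 0 ≤ t → p t = 0) := by
  -- The choice σ² = b τ equalizes the two off-diagonal coefficients of the system for (σ⁻¹ (b p +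
  -- stress), q), which makes the wave operator skew.
  obtain ⟨σ, hσ, hσ2⟩ : ∃ σ : ℝ, 0 < σ ∧ σ ^ 2 = b * τ :=
    ⟨√(b * τ), by positivity, Real.sq_sqrt (by positivity)⟩
  have hM0 : 0 ≤ M := by simpa using hM 0 le_rfl
  obtain ⟨B, hB1, hB2, hBs, hBd⟩ := exists_wave_operator T hT hTd (k := σ / b) (by positivity)
  obtain ⟨S, hS, hS0, hSl, hSu⟩ := exists_solution_operator_of_skew B hBs hBd
  have hTinj : ∀ x, T x = 0 → x = 0 := by
    intro x hx
    have h : ∀ y, inner ℝ x y = 0 := fun y => by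
      refine hTd.induction (P := fun y => inner ℝ x y = 0) ?_ ?_ y
      · rintro _ ⟨z, rfl⟩
        rw [← hT, hx, inner_zero_left]
      · exact isClosed_eq (continuous_const.inner continuous_id) continuous_const
    exact inner_self_eq_zero.1 (h x)
  -- the forcing term of the wave equation, the state, and the initial state
  let F : H → (ℝ → WithLp 2 (H × H)) → ℝ → WithLp 2 (H × H) := fun P₀ Z t =>
    WithLp.toLp 2 (σ⁻¹ • memoryStressRate c g P₀ (fun s => (Z s).fst) t, -((α / τ) • (Z t).snd))
  let V : H → (ℝ → WithLp 2 (H × H)) → ℝ → WithLp 2 (H × H) := fun P₀ Z t =>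
    WithLp.toLp 2 (σ⁻¹ • (b • (Z t).fst + memoryStress c g P₀ (fun s => (Z s).fst) t), (Z t).snd)
  let V₀ : H → H → H → WithLp 2 (H × H) := fun P₀ p₀ q₀ =>
    WithLp.toLp 2 (σ⁻¹ • (b • p₀ + c ^ 2 • P₀), q₀)
  -- Given a guess `Z` of (p, q), solve the wave equation with the forcing of `Z`, then solve the
  -- definition of the state for `p`, taking the memory stress of `Z`.
  let Φ : H → WithLp 2 (H × H) → (ℝ → WithLp 2 (H × H)) → ℝ → WithLp 2 (H × H) := fun P₀ U₀ Z t =>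
    WithLp.toLp 2 (b⁻¹ • (σ • (S U₀ (F P₀ Z) t).fst
      - memoryStress c g P₀ (fun s => (Z s).fst) t), (S U₀ (F P₀ Z) t).snd)
  have hfst : ∀ Z : ℝ → WithLp 2 (H × H), Continuous Z → Continuous fun s => (Z s).fst :=
    fun Z hZ => by fun_prop
  have hsnd : ∀ Z : ℝ → WithLp 2 (H × H), Continuous Z → Continuous fun s => (Z s).snd :=
    fun Z hZ => by fun_prop
  have hmk : ∀ x y : ℝ → H, Continuous x → Continuous y →
      Continuous fun t => WithLp.toLp 2 (x t, y t) := fun x y hx hy => by fun_prop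
  have hFc : ∀ P₀ Z, Continuous Z → Continuous (F P₀ Z) := fun P₀ Z hZ =>
    hmk _ _ ((continuous_memoryStressRate hg P₀ (hfst Z hZ)).const_smul _)
      ((hsnd Z hZ).const_smul _).neg
  have hVc : ∀ P₀ Z, Continuous Z → Continuous (V P₀ Z) := fun P₀ Z hZ =>
    hmk _ _ ((((hfst Z hZ).const_smul b).add
      (continuous_memoryStress hg P₀ (hfst Z hZ))).const_smul _) (hsnd Z hZ)
  have hΦc : ∀ P₀ U₀ Z, Continuous Z → Continuous (Φ P₀ U₀ Z) := fun P₀ U₀ Z hZ =>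
    have h := (hS U₀ _ (hFc P₀ Z hZ)).1
    hmk _ _ ((((hfst _ h).const_smul σ).sub
      (continuous_memoryStress hg P₀ (hfst Z hZ))).const_smul _) (hsnd _ h)
  -- the system is the abstract wave equation for the state
  have hequiv : ∀ P₀ p₀ q₀ Z, Continuous Z → ∀ t, 0 ≤ t →
      (B (V P₀ Z t) = B (V₀ P₀ p₀ q₀) + (∫ s in (0 : ℝ)..t, V P₀ Z s)
        + B (∫ s in (0 : ℝ)..t, F P₀ Z s) ↔
      T (Z t).fst = T p₀ + ∫ s in (0 : ℝ)..t, (Z s).snd ∧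
        τ • T (Z t).snd + α • T (∫ s in (0 : ℝ)..t, (Z s).snd)
          + ∫ s in (0 : ℝ)..t, (b • (Z s).fst + memoryStress c g P₀ (fun s => (Z s).fst) s)
            = τ • T q₀) := by
    intro P₀ p₀ q₀ Z hZ t ht
    have e1 : ∀ x y : WithLp 2 (H × H), x = y ↔ x.snd = y.snd ∧ x.fst = y.fst := fun x y => by
      rw [WithLp.ext_iff, Prod.ext_iff, and_comm]; rfl
    rw [e1]
    simp only [WithLp.add_fst, WithLp.add_snd, hB1, hB2, fst_intervalIntegral (hVc P₀ Z hZ),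
      snd_intervalIntegral (hVc P₀ Z hZ), fst_intervalIntegral (hFc P₀ Z hZ), snd_intervalIntegral (hFc P₀ Z hZ)]
    simp only [V, V₀, F, WithLp.toLp_fst, WithLp.toLp_snd, intervalIntegral.integral_smul,
      intervalIntegral.integral_neg, integral_memoryStressRate hg P₀ (hfst Z hZ) ht, map_smul,
      map_neg, map_add, map_sub]
    have k2 : (σ / b) • (σ⁻¹ • (b • T (Z t).fst + T (memoryStress c g P₀ (fun s => (Z s).fst) t)))
        - ((σ / b) • (σ⁻¹ • (b • T p₀ + c ^ 2 • T P₀)) + (∫ s in (0 : ℝ)..t, (Z s).snd)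
          + (σ / b) • (σ⁻¹ • (T (memoryStress c g P₀ (fun s => (Z s).fst) t) - c ^ 2 • T P₀)))
        = T (Z t).fst - (T p₀ + ∫ s in (0 : ℝ)..t, (Z s).snd) := by
      match_scalars <;> field_simp <;> ring
    have k1 : -((σ / b) • T (Z t).snd) - (-((σ / b) • T q₀)
          + σ⁻¹ • (∫ s in (0 : ℝ)..t, (b • (Z s).fst + memoryStress c g P₀ (fun s => (Z s).fst) s))
          + -((σ / b) • (-((α / τ) • T (∫ s in (0 : ℝ)..t, (Z s).snd)))))
        = (-σ⁻¹) • (τ • T (Z t).snd + α • T (∫ s in (0 : ℝ)..t, (Z s).snd)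
          + (∫ s in (0 : ℝ)..t, (b • (Z s).fst + memoryStress c g P₀ (fun s => (Z s).fst) s))
            - τ • T q₀) := by
      match_scalars <;> field_simp <;> rw [hσ2] <;> ring
    refine and_congr ?_ ?_
    · rw [← sub_eq_zero, k2, sub_eq_zero]
    · rw [← sub_eq_zero, k1, smul_eq_zero, or_iff_right (neg_ne_zero.2 (inv_ne_zero hσ.ne')),
        sub_eq_zero]
  set K : ℝ := σ⁻¹ * (c ^ 2 + M) + |α / τ|
  have hK0 : 0 ≤ K := by positivity
  have hle1 : ∀ Z : ℝ → WithLp 2 (H × H), Continuous Z → ∀ t, 0 ≤ t →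
      ∫ s in (0 : ℝ)..t, ‖(Z s).fst‖ ≤ ∫ s in (0 : ℝ)..t, ‖Z s‖ := fun Z hZ t ht =>
    intervalIntegral.integral_mono_on ht ((hfst Z hZ).norm.intervalIntegrable _ _)
      (hZ.norm.intervalIntegrable _ _) fun s _ => WithLp.norm_fst_le H _
  have hle2 : ∀ Z : ℝ → WithLp 2 (H × H), Continuous Z → ∀ t, 0 ≤ t →
      ∫ s in (0 : ℝ)..t, ‖(Z s).snd‖ ≤ ∫ s in (0 : ℝ)..t, ‖Z s‖ := fun Z hZ t ht =>
    intervalIntegral.integral_mono_on ht ((hsnd Z hZ).norm.intervalIntegrable _ _)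
      (hZ.norm.intervalIntegrable _ _) fun s _ => WithLp.norm_snd_le H _
  have hFint : ∀ P₀ Z, Continuous Z → ∀ t, 0 ≤ t → ∫ s in (0 : ℝ)..t, ‖F P₀ Z s‖
      ≤ K * (∫ s in (0 : ℝ)..t, ‖Z s‖) + σ⁻¹ * (M * ‖P₀‖) := by
    intro P₀ Z hZ t ht
    have c1 := (continuous_memoryStressRate (c := c) hg P₀ (hfst Z hZ)).norm
    have c2 := (hsnd Z hZ).norm
    have i1 : IntervalIntegrable (fun s => σ⁻¹ * ‖memoryStressRate c g P₀ (fun s => (Z s).fst) s‖)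
      volume 0 t := (continuous_const.mul c1).intervalIntegrable _ _
    have i2 : IntervalIntegrable (fun s => |α / τ| * ‖(Z s).snd‖) volume 0 t :=
      (continuous_const.mul c2).intervalIntegrable _ _
    have h1 : ∫ s in (0 : ℝ)..t, ‖F P₀ Z s‖ ≤ ∫ s in (0 : ℝ)..t,
        (σ⁻¹ * ‖memoryStressRate c g P₀ (fun s => (Z s).fst) s‖ + |α / τ| * ‖(Z s).snd‖) := by
      refine intervalIntegral.integral_mono_on ht ((hFc P₀ Z hZ).norm.intervalIntegrable _ _)
        (i1.add i2) fun s _ => (norm_toLp_le _ _).trans_eq ?_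
      rw [norm_neg, norm_smul, norm_smul, Real.norm_of_nonneg (inv_nonneg.2 hσ.le),
        Real.norm_eq_abs]
    rw [intervalIntegral.integral_add i1 i2, intervalIntegral.integral_const_mul,
      intervalIntegral.integral_const_mul] at h1
    have h2 := integral_norm_memoryStressRate_le (c := c) hg hM P₀ (hfst Z hZ) ht
    have h3 := mul_le_mul_of_nonneg_left (hle1 Z hZ t ht) (add_nonneg (sq_nonneg c) hM0)
    have h4 := mul_le_mul_of_nonneg_left (h2.trans (add_le_add_left h3 _)) (inv_nonneg.2 hσ.le)
    have h5 := mul_le_mul_of_nonneg_left (hle2 Z hZ t ht) (abs_nonneg (α / τ))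
    calc _ ≤ _ := h1
      _ ≤ _ := add_le_add h4 h5
      _ = _ := by ring
  have hrec : ∀ (U : WithLp 2 (H × H)) (R : H),
      ‖WithLp.toLp 2 (b⁻¹ • (σ • U.fst - R), U.snd)‖ ≤ (b⁻¹ * σ + 1) * ‖U‖ + b⁻¹ * ‖R‖ := by
    intro U R
    have h1 := norm_sub_le (σ • U.fst) R
    rw [norm_smul, Real.norm_of_nonneg hσ.le] at h1
    have h2 := mul_le_mul_of_nonneg_left (WithLp.norm_fst_le H U) hσ.le
    have h3 := mul_le_mul_of_nonneg_left (h1.trans (add_le_add_left h2 _)) (inv_nonneg.2 hb.le)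
    refine (norm_toLp_le _ _).trans ?_
    rw [norm_smul, Real.norm_of_nonneg (inv_nonneg.2 hb.le)]
    linarith [WithLp.norm_snd_le H U]
  -- The first summand bounds the wave solution through the forcing, the second the subtracted
  -- memory stress. The final 1 only ensures positivity.
  set C : ℝ := (b⁻¹ * σ + 1) * K + b⁻¹ * (c ^ 2 + M) + 1
  have hC : 0 < C := by positivity
  have hbσ : 0 ≤ b⁻¹ * σ + 1 := by positivity
  have hb0 : 0 ≤ b⁻¹ := by positivity
  have hΦl : ∀ P₀ U₀ Z Z', Continuous Z → Continuous Z' → ∀ t, 0 ≤ t →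
      ‖Φ P₀ U₀ Z t - Φ P₀ U₀ Z' t‖ ≤ C * ∫ s in (0 : ℝ)..t, ‖Z s - Z' s‖ := by
    intro P₀ U₀ Z Z' hZ hZ' t ht
    have hd : Continuous fun s => Z s - Z' s := hZ.sub hZ'
    -- The forcing is affine in `Z`, so differences reduce to the case `P₀ = 0` and the growth bound
    -- doubles as a Lipschitz bound.
    have hFd : ∀ s, F P₀ Z s - F P₀ Z' s = F 0 (fun s => Z s - Z' s) s := by
      intro s
      simp only [F, WithLp.sub_fst, WithLp.sub_snd]
      rw [← WithLp.toLp_sub, Prod.mk_sub_mk, ← smul_sub,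
        memoryStressRate_sub hg P₀ (hfst Z hZ) (hfst Z' hZ'), smul_sub]
      congr 2
      abel
    have h1 := hSl U₀ _ _ (hFc P₀ Z hZ) (hFc P₀ Z' hZ') t ht
    simp_rw [hFd] at h1
    have h2 := h1.trans (hFint 0 _ hd t ht)
    have h3 := norm_memoryStress_le (c := c) hg hM (0 : H) (hfst _ hd) ht
    have h4 := hle1 _ hd t ht
    have heq : Φ P₀ U₀ Z t - Φ P₀ U₀ Z' t
        = WithLp.toLp 2 (b⁻¹ • (σ • (S U₀ (F P₀ Z) t - S U₀ (F P₀ Z') t).fst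
          - memoryStress c g 0 (fun s => (Z s - Z' s).fst) t),
            (S U₀ (F P₀ Z) t - S U₀ (F P₀ Z') t).snd) := by
      have h := memoryStress_sub (c := c) hg P₀ P₀ (hfst Z hZ) (hfst Z' hZ') t
      rw [sub_self] at h
      simp only [Φ, WithLp.sub_fst, WithLp.sub_snd]
      rw [← h, ← WithLp.toLp_sub, Prod.mk_sub_mk]
      congr 2
      module
    rw [heq]
    refine (hrec _ _).trans ?_
    rw [norm_zero, mul_zero, mul_zero, add_zero] at h2
    rw [norm_zero, zero_add] at h3
    have h5 := h3.trans (mul_le_mul_of_nonneg_left h4 (add_nonneg (sq_nonneg c) hM0))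
    have h6 : 0 ≤ ∫ s in (0 : ℝ)..t, ‖Z s - Z' s‖ :=
      intervalIntegral.integral_nonneg ht fun _ _ => norm_nonneg _
    have h7 := add_le_add (mul_le_mul_of_nonneg_left h2 hbσ) (mul_le_mul_of_nonneg_left h5 hb0)
    simp only [C]
    linarith
  have hΦ0 : ∀ P₀ U₀ t, 0 ≤ t → ‖Φ P₀ U₀ (fun _ => 0) t‖
      ≤ (b⁻¹ * σ + 1) * (‖U₀‖ + σ⁻¹ * (M * ‖P₀‖)) + b⁻¹ * ((c ^ 2 + M) * ‖P₀‖) := by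
    intro P₀ U₀ t ht
    have h1 := hFint P₀ (fun _ => 0) continuous_const t ht
    have h2 := hS0 U₀ _ (hFc P₀ (fun _ => 0) continuous_const) t ht
    have h3 := norm_memoryStress_le (c := c) hg hM P₀ (hfst (fun _ => 0) continuous_const) ht
    simp only [WithLp.zero_fst, norm_zero, intervalIntegral.integral_zero, mul_zero, zero_add,
      add_zero] at h1 h3
    exact (hrec _ _).trans (add_le_add (mul_le_mul_of_nonneg_left
      (h2.trans (add_le_add_right h1 _)) hbσ) (mul_le_mul_of_nonneg_left h3 hb0))
  constructor
  · intro P₀ p₀ q₀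
    set D : ℝ := (b⁻¹ * σ + 1) * (‖V₀ P₀ p₀ q₀‖ + σ⁻¹ * (M * ‖P₀‖)) + b⁻¹ * ((c ^ 2 + M) * ‖P₀‖)
    have hD : 0 ≤ D := by positivity
    obtain ⟨Z, hZ, hfix⟩ := exists_volterra_fixedPoint (Φ P₀ (V₀ P₀ p₀ q₀)) (D := D)
      (hΦc _ _) hC (hΦl _ _) (fun t ht => (hΦ0 _ _ t ht).trans
        (le_mul_of_one_le_right hD (by linarith)))
    have hV : ∀ t, 0 ≤ t → V P₀ Z t = S (V₀ P₀ p₀ q₀) (F P₀ Z) t := by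
      intro t ht
      have h := hfix t ht
      have e1 : (Z t).fst = b⁻¹ • (σ • (S (V₀ P₀ p₀ q₀) (F P₀ Z) t).fst
        - memoryStress c g P₀ (fun s => (Z s).fst) t) := congrArg (fun x : WithLp 2 (H × H) => x.fst) h
      have e2 : (Z t).snd = (S (V₀ P₀ p₀ q₀) (F P₀ Z) t).snd :=
        (congrArg (fun x : WithLp 2 (H × H) => x.snd) h :)
      have e3 : σ⁻¹ • (b • (Z t).fst + memoryStress c g P₀ (fun s => (Z s).fst) t)
          = (S (V₀ P₀ p₀ q₀) (F P₀ Z) t).fst := by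
        rw [e1]
        match_scalars <;> field_simp
        ring
      simp only [V]
      rw [e3, e2]
      rfl
    have hsys : ∀ t, 0 ≤ t → T (Z t).fst = T p₀ + ∫ s in (0 : ℝ)..t, (Z s).snd ∧
        τ • T (Z t).snd + α • T (∫ s in (0 : ℝ)..t, (Z s).snd)
          + ∫ s in (0 : ℝ)..t, (b • (Z s).fst + memoryStress c g P₀ (fun s => (Z s).fst) s)
            = τ • T q₀ := by
      intro t ht
      refine (hequiv P₀ p₀ q₀ Z hZ t ht).1 ?_
      rw [hV t ht, (hS (V₀ P₀ p₀ q₀) _ (hFc P₀ Z hZ)).2 t ht]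
      congr 2
      refine intervalIntegral.integral_congr fun s hs => ?_
      rw [uIcc_of_le ht] at hs
      exact (hV s hs.1).symm
    refine ⟨fun t => (Z t).fst, fun t => (Z t).snd, hfst Z hZ, hsnd Z hZ, ?_, ?_, hsys⟩
    -- At t = 0 the integrated system determines only the images under `T`; injectivity of `T` gives
    -- the initial values themselves.
    · have h := (hsys 0 le_rfl).1
      rw [intervalIntegral.integral_same, add_zero] at h
      exact sub_eq_zero.1 (hTinj _ (by rw [map_sub, h, sub_self]))
    · have h := (hsys 0 le_rfl).2
      rw [intervalIntegral.integral_same, intervalIntegral.integral_same, map_zero, smul_zero,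
        add_zero, add_zero] at h
      have h := smul_right_injective H hτ.ne' h
      exact sub_eq_zero.1 (hTinj _ (by rw [map_sub, h, sub_self]))
  · intro p q hp hq h1 h2 t ht
    let Z : ℝ → WithLp 2 (H × H) := fun t => WithLp.toLp 2 (p t, q t)
    have hZ : Continuous Z := hmk p q hp hq
    have hV0 : V₀ 0 0 0 = 0 := by simp [V₀]
    have hV : ∀ t, 0 ≤ t → V 0 Z t = S 0 (F 0 Z) t := by
      refine hSu 0 (F 0 Z) (V 0 Z) (hFc 0 Z hZ) (hVc 0 Z hZ) fun t ht => ?_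
      have h := (hequiv 0 0 0 Z hZ t ht).2 ⟨by simpa [Z] using h1 t ht, by
        simpa [Z] using h2 t ht⟩
      rwa [hV0] at h
    have hfix : ∀ t, 0 ≤ t → Z t = Φ 0 0 Z t := by
      intro t ht
      simp only [Φ, ← hV t ht]
      simp only [V, WithLp.toLp_fst, WithLp.toLp_snd, Z, smul_smul, mul_inv_cancel₀ hσ.ne',
        one_smul, add_sub_cancel_right, inv_mul_cancel₀ hb.ne']
    have h0 : ∀ t, 0 ≤ t → Φ 0 0 (fun _ => 0) t = 0 := fun t ht => by
      have h := hΦ0 0 0 t ht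
      simp only [norm_zero, mul_zero, add_zero] at h
      exact norm_le_zero_iff.1 h
    have hz : Z t = 0 := eq_zero_of_norm_le_integral hZ (C := C) (fun t ht => by
      have h := hΦl 0 0 Z (fun _ => 0) hZ continuous_const t ht
      rw [h0 t ht, ← hfix t ht] at h
      simpa only [sub_zero] using h) ht
    exact congrArg (fun x : WithLp 2 (H × H) => x.fst) hz

end MemorySystem

/-! ### The square root as an isomorphism of the energy space onto H -/

namespace MGT

section HalfEquiv

variable {H : Type*} [NormedAddCommGroup H] [InnerProductSpace ℝ H] [CompleteSpace H]

theorem isSelfAdjoint_zero_linearPMap : IsSelfAdjoint (0 : H →ₗ.[ℝ] H) := by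
  have h0 : (0 : H →ₗ.[ℝ] H) = ((0 : H →L[ℝ] H) : H →ₗ[ℝ] H).toPMap ⊤ := by
    refine LinearPMap.ext rfl fun x y h => rfl
  rw [LinearPMap.isSelfAdjoint_def, h0,
    ContinuousLinearMap.toPMap_adjoint_eq_adjoint_toPMap_of_dense _ (by simp)]
  simp

/-- The operator `sqrtOp A` is self-adjoint: this is part of the definition of the square root, and the
zero operator, its default value, is self-adjoint too. -/
theorem isSelfAdjoint_sqrtOp (A : H →ₗ.[ℝ] H) : IsSelfAdjoint (sqrtOp A) := by
  unfold sqrtOp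
  split_ifs with h
  · exact h.choose_spec.1.isSelfAdjoint
  · exact isSelfAdjoint_zero_linearPMap

theorem inner_apply_eq_of_isSelfAdjoint {S : H →ₗ.[ℝ] H} (hS : IsSelfAdjoint S)
    (x y : S.domain) : inner ℝ (S x) (y : H) = inner ℝ (x : H) (S y) := by
  have h := LinearPMap.adjoint_isFormalAdjoint hS.dense_domain
  rw [LinearPMap.isSelfAdjoint_def.1 hS] at h
  exact h x y

/-- Self-adjointness as maximality: every pair formally adjoint to `S` lies in the graph of S* = S.
With w = 0 it identifies the orthogonal complement of the range with the kernel. -/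
theorem mem_graph_of_isSelfAdjoint {S : H →ₗ.[ℝ] H} (hS : IsSelfAdjoint S) {y w : H}
    (h : ∀ x : S.domain, inner ℝ w (x : H) = inner ℝ y (S x)) : (y, w) ∈ S.graph := by
  have hy := LinearPMap.mem_adjoint_domain_of_exists (T := S) y ⟨w, h⟩
  have hw := LinearPMap.adjoint_apply_eq hS.dense_domain ⟨y, hy⟩ h
  rw [← LinearPMap.isSelfAdjoint_def.1 hS, LinearPMap.mem_graph_iff]
  exact ⟨⟨y, hy⟩, rfl, hw⟩

namespace EnergySpace

variable (A : H →ₗ.[ℝ] H)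

theorem isometry_toGraph : Isometry (toGraph A) :=
  AddMonoidHomClass.isometry_of_norm (toGraph A) fun _ => rfl

theorem range_toGraph : range (toGraph A) = WithLp.ofLp ⁻¹' ((sqrtOp A).graph : Set (H × H)) := by
  ext z
  simp only [mem_range, mem_preimage, SetLike.mem_coe, LinearPMap.mem_graph_iff]
  constructor
  · rintro ⟨u, rfl⟩
    exact ⟨u, rfl, rfl⟩
  · rintro ⟨u, h1, h2⟩
    exact ⟨u, (WithLp.ofLp_injective 2) (Prod.ext h1 h2)⟩

/-- The graph norm identifies the space isometrically with the graph of a self-adjoint operator,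
which is closed. -/
instance instCompleteSpace : CompleteSpace (EnergySpace A) := by
  rw [completeSpace_iff_isComplete_range (isometry_toGraph A).isUniformInducing, range_toGraph]
  exact ((isSelfAdjoint_sqrtOp A).isClosed.preimage
    (WithLp.prod_continuous_ofLp 2 H H)).isComplete

theorem norm_half_le (u : EnergySpace A) : ‖half A u‖ ≤ ‖u‖ := by
  refine (pow_le_pow_iff_left₀ (norm_nonneg _) (norm_nonneg _) two_ne_zero).1 ?_
  rw [norm_sq_eq]
  exact le_add_of_nonneg_left (sq_nonneg _)

theorem norm_incl_le (u : EnergySpace A) : ‖incl A u‖ ≤ ‖u‖ := by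
  refine (pow_le_pow_iff_left₀ (norm_nonneg _) (norm_nonneg _) two_ne_zero).1 ?_
  rw [norm_sq_eq]
  exact le_add_of_nonneg_right (sq_nonneg _)

theorem norm_le_incl_add_half (u : EnergySpace A) : ‖u‖ ≤ ‖incl A u‖ + ‖half A u‖ := by
  refine (pow_le_pow_iff_left₀ (norm_nonneg _) (by positivity) two_ne_zero).1 ?_
  rw [norm_sq_eq]
  nlinarith [mul_nonneg (norm_nonneg (incl A u)) (norm_nonneg (half A u))]

variable {A}

/-- If `A^{1/2}` is bounded below, it is an isomorphism of `D(A^{1/2})` onto `H`, with bounded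
self-adjoint inverse `T` as an operator on `H`. -/
theorem exists_half_equiv (h : ∃ lam : ℝ, ∀ u : EnergySpace A, ‖incl A u‖ ≤ lam * ‖half A u‖) :
    ∃ (e : EnergySpace A ≃L[ℝ] H) (T : H →L[ℝ] H), (∀ u, e u = half A u) ∧
      (∀ u, T (half A u) = incl A u) ∧ (∀ x y, inner ℝ (T x) y = inner ℝ x (T y)) ∧
      DenseRange T := by
  obtain ⟨lam, hlam⟩ := h
  have hS := isSelfAdjoint_sqrtOp A
  let f : EnergySpace A →L[ℝ] H := (half A).mkContinuous 1 (by simpa using norm_half_le A)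
  let i : EnergySpace A →L[ℝ] H := (incl A).mkContinuous 1 (by simpa using norm_incl_le A)
  -- Coercivity bounds the whole graph norm by ‖A^{1/2} u‖, so the range is closed; `|lam|` is used
  -- because `lam` carries no sign.
  have hanti : AntilipschitzWith (Real.toNNReal (|lam| + 1)) f := by
    refine f.antilipschitz_of_bound fun u => ?_
    rw [Real.coe_toNNReal _ (by positivity)]
    have h1 := norm_le_incl_add_half A u
    have h2 := hlam u
    have h3 := mul_le_mul_of_nonneg_right (le_abs_self lam) (norm_nonneg (half A u))
    change ‖u‖ ≤ (|lam| + 1) * ‖half A u‖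
    linarith
  have hdense : DenseRange f := by
    have h1 : (LinearMap.range (f : EnergySpace A →ₗ[ℝ] H)).topologicalClosure = ⊤ := by
      rw [Submodule.topologicalClosure_eq_top_iff, Submodule.eq_bot_iff]
      intro y hy
      have hg : (y, (0 : H)) ∈ (sqrtOp A).graph := mem_graph_of_isSelfAdjoint hS fun x => by
        rw [inner_zero_left, real_inner_comm]
        exact (hy (half A x) ⟨x, rfl⟩).symm
      obtain ⟨u, hu, hu0⟩ := (LinearPMap.mem_graph_iff _).1 hg
      have h2 := hlam u
      have h3 : half A u = 0 := hu0
      rw [h3, norm_zero, mul_zero] at h2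
      exact hu.symm.trans (norm_le_zero_iff.1 h2)
    have h2 := Submodule.dense_iff_topologicalClosure_eq_top.2 h1
    exact h2
  have hsurj : Function.Surjective f := by
    rw [← range_eq_univ, ← (hanti.isClosed_range f.uniformContinuous).closure_eq]
    exact hdense.closure_range
  let e : EnergySpace A ≃L[ℝ] H := ContinuousLinearEquiv.ofBijective f
    (LinearMap.ker_eq_bot.2 hanti.injective) (LinearMap.range_eq_top.2 hsurj)
  have he : ∀ u, e u = half A u := fun _ => rfl
  have hT : ∀ u, (i ∘L e.symm.toContinuousLinearMap) (half A u) = incl A u := fun u => by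
    rw [← he]
    exact congrArg (incl A) (e.symm_apply_apply u)
  refine ⟨e, i ∘L e.symm.toContinuousLinearMap, he, hT, fun x y => ?_, ?_⟩
  · obtain ⟨u, rfl⟩ := hsurj x
    obtain ⟨v, rfl⟩ := hsurj y
    change inner ℝ ((i ∘L e.symm.toContinuousLinearMap) (half A u)) (half A v)
      = inner ℝ (half A u) ((i ∘L e.symm.toContinuousLinearMap) (half A v))
    rw [hT, hT]
    exact (inner_apply_eq_of_isSelfAdjoint hS u v).symm
  · refine hS.dense_domain.mono fun x hx => ?_
    exact ⟨half A ⟨x, hx⟩, hT _⟩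

end EnergySpace

end HalfEquiv

end MGT

/-! ### Weak solutions: uniqueness, existence and regularity -/

namespace MGT

section WeakForm

variable {H : Type*} [NormedAddCommGroup H] [InnerProductSpace ℝ H]

-- Weak derivatives are controlled only on (0, T]. Cutting them off at 0 makes their primitives
-- continuous on the whole line without changing the integrals over [0, t].
omit [InnerProductSpace ℝ H] in
theorem intervalIntegrable_indicator_Ioi {f : ℝ → H} (hf : ∀ T : ℝ, IntegrableOn f (Ioc 0 T))
    (x y : ℝ) : IntervalIntegrable ((Ioi 0).indicator f) volume x y := by
  rw [intervalIntegrable_iff, integrableOn_indicator_iff measurableSet_Ioi]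
  refine (hf (max x y)).mono_set fun t ht => ?_
  exact ⟨ht.1, ht.2.2⟩

theorem integral_indicator_Ioi (f : ℝ → H) {t : ℝ} (ht : 0 ≤ t) :
    ∫ s in (0 : ℝ)..t, (Ioi 0).indicator f s = ∫ s in (0 : ℝ)..t, f s := by
  rw [intervalIntegral.integral_of_le ht, intervalIntegral.integral_of_le ht]
  exact setIntegral_congr_fun measurableSet_Ioc fun s hs => indicator_of_mem (mem_Ioi.2 hs.1) f

theorem memLp_restrict_Ioc_of_continuous {E : Type*} [NormedAddCommGroup E] {f : ℝ → E}
    (hf : Continuous f) (T : ℝ) : MemLp f 2 (volume.restrict (Ioc 0 T)) := by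
  obtain ⟨C, hC⟩ := (isCompact_Icc (a := (0 : ℝ)) (b := T)).exists_bound_of_continuousOn
    hf.continuousOn
  refine MemLp.of_bound hf.aestronglyMeasurable C ?_
  filter_upwards [ae_restrict_mem measurableSet_Ioc] with s hs
  exact hC s (Ioc_subset_Icc_self hs)

theorem intervalIntegral_inner_left [CompleteSpace H] {f : ℝ → H} {a b : ℝ}
    (hf : IntervalIntegrable f volume a b) (x : H) :
    ∫ s in a..b, inner ℝ (f s) x = inner ℝ (∫ s in a..b, f s) x := by
  have h := (innerSL ℝ x).intervalIntegral_comp_comm hf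
  simp only [innerSL_apply_apply] at h
  simp_rw [real_inner_comm x]
  exact h

theorem intervalIntegrable_clm_apply (T : H →L[ℝ] H) {f : ℝ → H} {a b : ℝ}
    (hf : IntervalIntegrable f volume a b) : IntervalIntegrable (fun s => T (f s)) volume a b :=
  ⟨T.integrable_comp hf.1, T.integrable_comp hf.2⟩

variable [CompleteSpace H] {A : H →ₗ.[ℝ] H}

/-- The weak form of the equation, tested against `φ`, as an inner product with `A^{1/2} φ`. -/
theorem weakForm_eq_inner {T : H →L[ℝ] H} (hT : ∀ x y, inner ℝ (T x) y = inner ℝ x (T y))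
    (hTh : ∀ u : EnergySpace A, T (EnergySpace.half A u) = EnergySpace.incl A u)
    (τ α b c : ℝ) {g : ℝ → ℝ} {G : ℝ → ℝ} (hG : Continuous G) (hGg : ∀ t, 0 ≤ t → G t = g t)
    {u v : ℝ → EnergySpace A} {w P : ℝ → H} (hP : Continuous P) {t : ℝ} (ht : 0 ≤ t)
    (hu : ∀ s ∈ Icc 0 t, EnergySpace.half A (u s) = P s)
    (hv : IntervalIntegrable (fun s => EnergySpace.half A (v s)) volume 0 t)
    (hw : IntervalIntegrable w volume 0 t) (φ : EnergySpace A) :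
    τ * inner ℝ (w t) (EnergySpace.incl A φ) +
        ∫ s in (0 : ℝ)..t,
          (α * inner ℝ (w s) (EnergySpace.incl A φ)
            + c ^ 2 * inner ℝ (EnergySpace.half A (u s)) (EnergySpace.half A φ)
            + b * inner ℝ (EnergySpace.half A (v s)) (EnergySpace.half A φ)
            - ∫ r in (0 : ℝ)..s,
                g (s - r) * inner ℝ (EnergySpace.half A (u r)) (EnergySpace.half A φ))
      = inner ℝ (T (τ • w t + α • ∫ s in (0 : ℝ)..t, w s)
          + ∫ s in (0 : ℝ)..t, (b • EnergySpace.half A (v s)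
            + (c ^ 2 • P s - volterraConv G P s))) (EnergySpace.half A φ) := by
  have hS : Continuous fun s => c ^ 2 • P s - volterraConv G P s :=
    (hP.const_smul (c ^ 2)).sub (continuous_volterraConv hG hP)
  have i1 : IntervalIntegrable (fun s => b • EnergySpace.half A (v s)
      + (c ^ 2 • P s - volterraConv G P s)) volume 0 t :=
    (hv.smul b).add (hS.intervalIntegrable _ _)
  have iw : IntervalIntegrable (fun s => α • w s) volume 0 t := hw.smul α
  have i2 : IntervalIntegrable (fun s => T (α • w s)) volume 0 t := intervalIntegrable_clm_apply T iw
  have hconv : ∀ s ∈ Icc 0 t, ∫ r in (0 : ℝ)..s,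
      g (s - r) * inner ℝ (EnergySpace.half A (u r)) (EnergySpace.half A φ)
      = inner ℝ (volterraConv G P s) (EnergySpace.half A φ) := by
    intro s hs
    have hc : Continuous fun r => G (s - r) • P r :=
      (hG.comp (continuous_const.sub continuous_id)).smul hP
    rw [volterraConv, ← intervalIntegral_inner_left (hc.intervalIntegrable _ _)]
    refine intervalIntegral.integral_congr fun r hr => ?_
    rw [uIcc_of_le hs.1] at hr
    simp only [inner_smul_left, hGg _ (sub_nonneg.2 hr.2), hu r ⟨hr.1, hr.2.trans hs.2⟩]
    simp
  have hint : ∫ s in (0 : ℝ)..t,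
          (α * inner ℝ (w s) (EnergySpace.incl A φ)
            + c ^ 2 * inner ℝ (EnergySpace.half A (u s)) (EnergySpace.half A φ)
            + b * inner ℝ (EnergySpace.half A (v s)) (EnergySpace.half A φ)
            - ∫ r in (0 : ℝ)..s,
                g (s - r) * inner ℝ (EnergySpace.half A (u r)) (EnergySpace.half A φ))
      = ∫ s in (0 : ℝ)..t, inner ℝ (T (α • w s) + (b • EnergySpace.half A (v s)
            + (c ^ 2 • P s - volterraConv G P s))) (EnergySpace.half A φ) := by
    refine intervalIntegral.integral_congr fun s hs => ?_
    rw [uIcc_of_le ht] at hs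
    -- Here φ = T A^{1/2} φ, and symmetry moves `T` onto `w`, so every term is tested against
    -- A^{1/2} φ.
    simp only [hconv s hs, hu s hs, inner_add_left, inner_sub_left, hT, hTh, inner_smul_left]
    simp
    ring
  rw [hint, intervalIntegral_inner_left (i2.add i1), intervalIntegral.integral_add i2 i1,
    T.intervalIntegral_comp_comm iw, map_add, ← hTh φ, ← hT]
  simp only [intervalIntegral.integral_smul, inner_add_left, inner_smul_left, map_smul]
  simp
  ring

/-- A weak solution, integrated once more in time, satisfies an identity between continuous
functions in which only `P = A^{1/2} u` and `Q = u_t` occur. -/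
theorem IsWeakSolution.exists_integrated {T : H →L[ℝ] H}
    (hT : ∀ x y, inner ℝ (T x) y = inner ℝ x (T y))
    {e : EnergySpace A ≃L[ℝ] H} (he : ∀ u, e u = EnergySpace.half A u)
    (hTh : ∀ u : EnergySpace A, T (EnergySpace.half A u) = EnergySpace.incl A u)
    {τ α b c : ℝ} {g : ℝ → ℝ} {G : ℝ → ℝ} (hG : Continuous G) (hGg : ∀ t, 0 ≤ t → G t = g t)
    {u₀ u₁ : EnergySpace A} {u₂ : H} {u : ℝ → EnergySpace A}
    (h : IsWeakSolution A τ α b c g u₀ u₁ u₂ u) :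
    ∃ P Q : ℝ → H, Continuous P ∧ Continuous Q ∧ ∀ t, 0 ≤ t →
      EnergySpace.half A (u t) = P t ∧
      T (P t) = EnergySpace.incl A u₀ + ∫ s in (0 : ℝ)..t, Q s ∧
      τ • T (Q t) + α • T (∫ s in (0 : ℝ)..t, Q s)
        + ∫ s in (0 : ℝ)..t, (b • P s
          + ∫ r in (0 : ℝ)..s, (c ^ 2 • P r - volterraConv G P r))
        = τ • T (EnergySpace.incl A u₁) + t • (α • T (EnergySpace.incl A u₁) + τ • T u₂
          + b • EnergySpace.half A u₀) := by
  obtain ⟨v₀, w₀, hv₀, hw₀, hu, hvw, heq⟩ := h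
  have hvi : ∀ t : ℝ, IntegrableOn v₀ (Ioc 0 t) := fun t => (hv₀ t).integrable one_le_two
  have hwi : ∀ t : ℝ, IntegrableOn w₀ (Ioc 0 t) := fun t => (hw₀ t).integrable one_le_two
  set w := (Ioi 0).indicator w₀
  set p : ℝ → H := (Ioi 0).indicator fun s => EnergySpace.half A (v₀ s)
  have hpi₀ : ∀ t : ℝ, IntegrableOn (fun s => EnergySpace.half A (v₀ s)) (Ioc 0 t) := fun t => by
    simp_rw [← he]
    exact e.toContinuousLinearMap.integrable_comp (hvi t)
  have hw : ∀ x y, IntervalIntegrable w volume x y := intervalIntegrable_indicator_Ioi hwi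
  have hp : ∀ x y, IntervalIntegrable p volume x y := intervalIntegrable_indicator_Ioi hpi₀
  have hcp : Continuous fun t => ∫ s in (0 : ℝ)..t, p s :=
    intervalIntegral.continuous_primitive hp 0
  have hcw : Continuous fun t => ∫ s in (0 : ℝ)..t, w s :=
    intervalIntegral.continuous_primitive hw 0
  set P : ℝ → H := fun t => EnergySpace.half A u₀ + ∫ s in (0 : ℝ)..t, p s
  set Q : ℝ → H := fun t => EnergySpace.incl A u₁ + ∫ s in (0 : ℝ)..t, w s
  have hP : Continuous P := continuous_const.add hcp
  have hQ : Continuous Q := continuous_const.add hcw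
  have hS : Continuous fun s => c ^ 2 • P s - volterraConv G P s :=
    (hP.const_smul (c ^ 2)).sub (continuous_volterraConv hG hP)
  have hR : Continuous fun s => ∫ r in (0 : ℝ)..s, (c ^ 2 • P r - volterraConv G P r) :=
    continuous_primitive_of_continuous hS
  have huP : ∀ t, 0 ≤ t → EnergySpace.half A (u t) = P t := by
    intro t ht
    have h1 := e.toContinuousLinearMap.intervalIntegral_comp_comm (f := v₀) (μ := volume)
      (a := 0) (b := t) ((intervalIntegrable_iff_integrableOn_Ioc_of_le ht).2 (hvi t))
    simp only [ContinuousLinearEquiv.coe_coe, he] at h1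
    simp only [P, p]
    rw [hu t ht, map_add, ← h1, integral_indicator_Ioi _ ht]
  have hTP : ∀ t, 0 ≤ t → T (P t) = EnergySpace.incl A u₀ + ∫ s in (0 : ℝ)..t, Q s := by
    intro t ht
    simp only [P]
    rw [map_add, hTh, ← T.intervalIntegral_comp_comm (hp 0 t)]
    congr 1
    refine intervalIntegral.integral_congr_ae ?_
    rw [ae_restrict_iff' measurableSet_Ioi] at hvw
    filter_upwards [hvw] with s hs hst
    rw [uIoc_of_le ht] at hst
    have hs0 : s ∈ Ioi (0 : ℝ) := hst.1
    simp only [p, Q, w]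
    rw [indicator_of_mem hs0, hTh, hs hs0, integral_indicator_Ioi _ hst.1.le]
  refine ⟨P, Q, hP, hQ, fun t ht => ⟨huP t ht, hTP t ht, ?_⟩⟩
  set N : ℝ → H := fun s => T (τ • w s + α • ∫ r in (0 : ℝ)..s, w r)
    + (b • (∫ r in (0 : ℝ)..s, p r) + ∫ r in (0 : ℝ)..s, (c ^ 2 • P r - volterraConv G P r))
  have iw : IntervalIntegrable (fun s => τ • w s + α • ∫ r in (0 : ℝ)..s, w r) volume 0 t :=
    ((hw 0 t).smul τ).add ((hcw.const_smul α).intervalIntegrable _ _)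
  have ip : IntervalIntegrable (fun s => b • (∫ r in (0 : ℝ)..s, p r)
      + ∫ r in (0 : ℝ)..s, (c ^ 2 • P r - volterraConv G P r)) volume 0 t :=
    ((hcp.const_smul b).add hR).intervalIntegrable _ _
  have iN : IntervalIntegrable N volume 0 t := (intervalIntegrable_clm_apply T iw).add ip
  -- The exceptional null set in the weak form depends on φ. Integrating in time first removes it,
  -- and only then is φ varied; A^{1/2} φ ranges over all of H.
  have hN : ∫ s in (0 : ℝ)..t, N s = t • τ • T u₂ := by
    refine ext_inner_right ℝ fun ψ => ?_
    rw [← intervalIntegral_inner_left iN]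
    have hψ : EnergySpace.half A (e.symm ψ) = ψ := by rw [← he, e.apply_symm_apply]
    have hae : ∫ s in (0 : ℝ)..t, inner ℝ (N s) ψ = ∫ s in (0 : ℝ)..t, inner ℝ (τ • T u₂) ψ := by
      refine intervalIntegral.integral_congr_ae ?_
      have hφ := heq (e.symm ψ)
      rw [ae_restrict_iff' measurableSet_Ioi] at hφ
      filter_upwards [hφ] with s hs hst
      rw [uIoc_of_le ht] at hst
      have hs0 : s ∈ Ioi (0 : ℝ) := hst.1
      have h1 := hs hs0
      have iv : IntervalIntegrable (fun r => b • EnergySpace.half A (v₀ r)) volume 0 s :=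
        ((intervalIntegrable_iff_integrableOn_Ioc_of_le hst.1.le).2 (hpi₀ s)).smul b
      rw [weakForm_eq_inner hT hTh τ α b c hG hGg hP hst.1.le (fun r hr => huP r hr.1)
        ((intervalIntegrable_iff_integrableOn_Ioc_of_le hst.1.le).2 (hpi₀ s))
        ((intervalIntegrable_iff_integrableOn_Ioc_of_le hst.1.le).2 (hwi s)), ← hTh, hψ, ← hT,
        intervalIntegral.integral_add iv (hS.intervalIntegrable _ _), intervalIntegral.integral_smul,
        ← integral_indicator_Ioi _ hst.1.le,
        ← integral_indicator_Ioi (fun s => EnergySpace.half A (v₀ s)) hst.1.le] at h1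
      rw [inner_smul_left]
      simp only [N]
      simp only [w, indicator_of_mem hs0]
      exact h1
    rw [hae, intervalIntegral.integral_const, sub_zero]
    simp [inner_smul_left]
  have hQw : ∀ s, ∫ r in (0 : ℝ)..s, w r = Q s - EnergySpace.incl A u₁ := fun s => by
    simp only [Q, add_sub_cancel_left]
  have hPp : ∀ s, ∫ r in (0 : ℝ)..s, p r = P s - EnergySpace.half A u₀ := fun s => by
    simp only [P, add_sub_cancel_left]
  have iQ := hQ.intervalIntegrable (μ := volume) 0 t
  have iP := hP.intervalIntegrable (μ := volume) 0 t
  have iR := hR.intervalIntegrable (μ := volume) 0 t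
  have e1 : ∫ s in (0 : ℝ)..t, N s = T (τ • (Q t - EnergySpace.incl A u₁)
      + α • ((∫ s in (0 : ℝ)..t, Q s) - t • EnergySpace.incl A u₁))
      + (b • ((∫ s in (0 : ℝ)..t, P s) - t • EnergySpace.half A u₀)
        + ∫ s in (0 : ℝ)..t, ∫ r in (0 : ℝ)..s, (c ^ 2 • P r - volterraConv G P r)) := by
    simp only [N]
    have j1 : IntervalIntegrable (fun s => τ • w s) volume 0 t := (hw 0 t).smul τ
    have j2 : Continuous fun s => α • ∫ r in (0 : ℝ)..s, w r := hcw.const_smul α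
    have j3 : Continuous fun s => b • ∫ r in (0 : ℝ)..s, p r := hcp.const_smul b
    rw [intervalIntegral.integral_add (intervalIntegrable_clm_apply T iw) ip,
      T.intervalIntegral_comp_comm iw, intervalIntegral.integral_add j1
        (j2.intervalIntegrable _ _), intervalIntegral.integral_add
        (j3.intervalIntegrable _ _) iR, intervalIntegral.integral_smul,
      intervalIntegral.integral_smul, intervalIntegral.integral_smul]
    simp only [hQw, hPp]
    rw [intervalIntegral.integral_sub iQ intervalIntegrable_const,
      intervalIntegral.integral_sub iP intervalIntegrable_const,
      intervalIntegral.integral_const, intervalIntegral.integral_const, sub_zero]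
  have ibP : IntervalIntegrable (fun s => b • P s) volume 0 t := iP.smul b
  rw [intervalIntegral.integral_add ibP iR, intervalIntegral.integral_smul]
  rw [e1] at hN
  simp only [map_add, map_sub, map_smul] at hN
  rw [← sub_eq_zero] at hN ⊢
  rw [← hN]
  module

/-- Weak solutions with the same data coincide. -/
theorem IsWeakSolution.eqOn
    (hco : ∃ lam : ℝ, ∀ u : EnergySpace A, ‖EnergySpace.incl A u‖ ≤ lam * ‖EnergySpace.half A u‖)
    {τ α b c : ℝ} (hτ : 0 < τ) (hb : 0 < b) {g : ℝ → ℝ} {G : ℝ → ℝ} (hG : Continuous G)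
    (hGg : ∀ t, 0 ≤ t → G t = g t) {M : ℝ} (hM : ∀ t, 0 ≤ t → ∫ s in (0 : ℝ)..t, ‖G s‖ ≤ M)
    {u₀ u₁ : EnergySpace A} {u₂ : H} {u u' : ℝ → EnergySpace A}
    (h : IsWeakSolution A τ α b c g u₀ u₁ u₂ u) (h' : IsWeakSolution A τ α b c g u₀ u₁ u₂ u') :
    EqOn u u' (Ici 0) := by
  obtain ⟨e, T, he, hTh, hT, hTd⟩ := EnergySpace.exists_half_equiv hco
  obtain ⟨P, Q, hP, hQ, hs⟩ := h.exists_integrated hT he hTh hG hGg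
  obtain ⟨P', Q', hP', hQ', hs'⟩ := h'.exists_integrated hT he hTh hG hGg
  have hd : Continuous fun s => P s - P' s := hP.sub hP'
  have hrate : ∀ s, (c ^ 2 • P s - volterraConv G P s) - (c ^ 2 • P' s - volterraConv G P' s)
      = memoryStressRate c G 0 (fun s => P s - P' s) s := by
    intro s
    simp only [memoryStressRate]
    rw [volterraConv_sub hG hP hP']
    module
  have hS : ∀ f : ℝ → H, Continuous f → Continuous fun s => c ^ 2 • f s - volterraConv G f s :=
    fun f hf => (hf.const_smul (c ^ 2)).sub (continuous_volterraConv hG hf)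
  have hstress : ∀ s, 0 ≤ s → (∫ r in (0 : ℝ)..s, (c ^ 2 • P r - volterraConv G P r))
      - (∫ r in (0 : ℝ)..s, (c ^ 2 • P' r - volterraConv G P' r))
      = memoryStress c G 0 (fun s => P s - P' s) s := by
    intro s hs
    rw [← intervalIntegral.integral_sub ((hS P hP).intervalIntegrable _ _)
      ((hS P' hP').intervalIntegrable _ _), intervalIntegral.integral_congr fun r _ => hrate r,
      integral_memoryStressRate hG 0 hd hs, smul_zero, sub_zero]
  -- The system is used one time derivative lower: the difference of A^{1/2} u takes the place of
  -- `p`, that of u_t the place of `q`, and all initial data cancel.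
  have hzero := (memory_system_wellPosed T hT hTd hτ hb α c hG hM).2 (fun s => P s - P' s)
    (fun s => Q s - Q' s) hd (hQ.sub hQ') (fun t ht => by
      rw [map_sub, (hs t ht).2.1, (hs' t ht).2.1, intervalIntegral.integral_sub
        (hQ.intervalIntegrable _ _) (hQ'.intervalIntegrable _ _)]
      abel) (fun t ht => by
      have hc : ∀ f : ℝ → H, Continuous f → IntervalIntegrable (fun s => b • f s
          + ∫ r in (0 : ℝ)..s, (c ^ 2 • f r - volterraConv G f r)) volume 0 t := fun f hf =>
        ((hf.const_smul b).add
          (continuous_primitive_of_continuous (hS f hf))).intervalIntegrable _ _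
      have hint : ∫ s in (0 : ℝ)..t, (b • (P s - P' s) + memoryStress c G 0 (fun s => P s - P' s) s)
          = (∫ s in (0 : ℝ)..t, (b • P s
              + ∫ r in (0 : ℝ)..s, (c ^ 2 • P r - volterraConv G P r)))
            - ∫ s in (0 : ℝ)..t, (b • P' s
              + ∫ r in (0 : ℝ)..s, (c ^ 2 • P' r - volterraConv G P' r)) := by
        rw [← intervalIntegral.integral_sub (hc P hP) (hc P' hP')]
        refine intervalIntegral.integral_congr fun s hs => ?_
        rw [uIcc_of_le ht] at hs
        simp only [← hstress s hs.1]
        module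
      have h2 := (hs t ht).2.2.trans (hs' t ht).2.2.symm
      rw [hint, intervalIntegral.integral_sub (hQ.intervalIntegrable _ _)
        (hQ'.intervalIntegrable _ _), map_sub, map_sub]
      rw [← sub_eq_zero] at h2
      rw [← h2]
      module)
  intro t ht
  refine e.injective ?_
  rw [he, he, (hs t ht).1, (hs' t ht).1]
  exact sub_eq_zero.1 (hzero t ht)

theorem hasDerivAt_primitive {E : Type*} [NormedAddCommGroup E] [NormedSpace ℝ E]
    [CompleteSpace E] (x : E) {f : ℝ → E} (hf : Continuous f) (t : ℝ) :
    HasDerivAt (fun t => x + ∫ s in (0 : ℝ)..t, f s) (f t) t :=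
  (intervalIntegral.integral_hasDerivAt_right (hf.intervalIntegrable _ _)
    (hf.stronglyMeasurableAtFilter _ _) hf.continuousAt).const_add x

theorem contDiff_primitive {E : Type*} [NormedAddCommGroup E] [NormedSpace ℝ E]
    [CompleteSpace E] (x : E) {f : ℝ → E} {n : ℕ} (hf : ContDiff ℝ n f) :
    ContDiff ℝ (n + 1) (fun t => x + ∫ s in (0 : ℝ)..t, f s) := by
  refine contDiff_succ_iff_deriv.2 ⟨fun t =>
    (hasDerivAt_primitive x hf.continuous t).differentiableAt, by simp, ?_⟩
  rwa [funext fun t => (hasDerivAt_primitive x hf.continuous t).deriv]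

/-- Existence of a weak solution with the regularity `C¹([0, ∞); D(A^{1/2})) ∩ C²([0, ∞); H)`. -/
theorem exists_isWeakSolution
    (hco : ∃ lam : ℝ, ∀ u : EnergySpace A, ‖EnergySpace.incl A u‖ ≤ lam * ‖EnergySpace.half A u‖)
    {τ α b c : ℝ} (hτ : 0 < τ) (hb : 0 < b) {g : ℝ → ℝ} {G : ℝ → ℝ} (hG : Continuous G)
    (hGg : ∀ t, 0 ≤ t → G t = g t) {M : ℝ} (hM : ∀ t, 0 ≤ t → ∫ s in (0 : ℝ)..t, ‖G s‖ ≤ M)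
    (u₀ u₁ : EnergySpace A) (u₂ : H) :
    ∃ u : ℝ → EnergySpace A, IsWeakSolution A τ α b c g u₀ u₁ u₂ u ∧
      ContDiffOn ℝ 1 u (Ici 0) ∧ ContDiffOn ℝ 2 (fun t => EnergySpace.incl A (u t)) (Ici 0) ∧
      derivWithin u (Ici 0) 0 = u₁ ∧
      iteratedDerivWithin 2 (fun t => EnergySpace.incl A (u t)) (Ici 0) 0 = u₂ := by
  obtain ⟨e, T, he, hTh, hT, hTd⟩ := EnergySpace.exists_half_equiv hco
  obtain ⟨p, q, hp, hq, hp0, hq0, hsys⟩ := (memory_system_wellPosed T hT hTd hτ hb α c hG hM).1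
    (EnergySpace.half A u₀) (EnergySpace.half A u₁) u₂
  have hhalf : ∀ x, EnergySpace.half A (e.symm x) = x := fun x => by rw [← he, e.apply_symm_apply]
  have hv : Continuous fun t => e.symm (p t) := e.symm.continuous.comp hp
  have hP : ∀ t, EnergySpace.half A (u₀ + ∫ s in (0 : ℝ)..t, e.symm (p s))
      = EnergySpace.half A u₀ + ∫ s in (0 : ℝ)..t, p s := by
    intro t
    rw [map_add, ← he (∫ s in (0 : ℝ)..t, e.symm (p s))]
    congr 1
    have h := e.toContinuousLinearMap.intervalIntegral_comp_comm (μ := volume)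
      (hv.intervalIntegrable 0 t)
    simpa using h.symm
  have hvq : ∀ t, 0 ≤ t → EnergySpace.incl A (e.symm (p t))
      = EnergySpace.incl A u₁ + ∫ s in (0 : ℝ)..t, q s := by
    intro t ht
    rw [← hTh, ← hTh, hhalf]
    exact (hsys t ht).1
  -- On [0, ∞) the solution agrees in H with a double primitive of `q` that is C² on the whole line,
  -- so its one-sided derivatives are ordinary derivatives of that primitive.
  have hinclu : ∀ t ∈ Ici (0 : ℝ), EnergySpace.incl A (u₀ + ∫ s in (0 : ℝ)..t, e.symm (p s))
      = EnergySpace.incl A u₀ + ∫ s in (0 : ℝ)..t,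
        (EnergySpace.incl A u₁ + ∫ r in (0 : ℝ)..s, q r) := by
    intro t ht
    rw [← hTh, hP, map_add, hTh, ← T.intervalIntegral_comp_comm (hp.intervalIntegrable _ _)]
    congr 1
    refine intervalIntegral.integral_congr fun s hs => ?_
    rw [uIcc_of_le ht] at hs
    simp only [← hvq s hs.1]
    rw [← hTh, hhalf]
  have hQ : ContDiff ℝ (1 : ℕ) fun t => EnergySpace.incl A u₁ + ∫ s in (0 : ℝ)..t, q s := by
    simpa using contDiff_primitive (n := 0) (EnergySpace.incl A u₁)
      (contDiff_zero.2 hq)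
  have hinc : ContDiff ℝ 2 fun t => EnergySpace.incl A u₀ + ∫ s in (0 : ℝ)..t,
      (EnergySpace.incl A u₁ + ∫ r in (0 : ℝ)..s, q r) := by
    simpa [one_add_one_eq_two] using contDiff_primitive (EnergySpace.incl A u₀) hQ
  refine ⟨fun t => u₀ + ∫ s in (0 : ℝ)..t, e.symm (p s),
    ⟨fun t => e.symm (p t), q, memLp_restrict_Ioc_of_continuous hv,
      memLp_restrict_Ioc_of_continuous hq, fun _ _ => rfl, ?_, fun φ => ?_⟩, ?_, ?_, ?_, ?_⟩
  · filter_upwards [ae_restrict_mem measurableSet_Ioi] with t ht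
    exact hvq t (mem_Ioi.1 ht).le
  · filter_upwards [ae_restrict_mem measurableSet_Ioi] with t ht
    have ht : 0 ≤ t := (mem_Ioi.1 ht).le
    rw [weakForm_eq_inner hT hTh τ α b c hG hGg
      (continuous_const.add (continuous_primitive_of_continuous hp)) ht (fun s _ => hP s)
      (by simpa only [hhalf] using hp.intervalIntegrable _ _) (hq.intervalIntegrable _ _)]
    have h := (hsys t ht).2
    simp only [hhalf, map_add, map_smul, ← hTh φ, ← hT]
    have hi : inner ℝ (τ • T u₂) (EnergySpace.half A φ)
        = τ * inner ℝ (T u₂) (EnergySpace.half A φ) := by simp [inner_smul_left]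
    rw [← hi, ← h]
    rfl
  · have h : ContDiff ℝ 1 fun t => u₀ + ∫ s in (0 : ℝ)..t, e.symm (p s) := by
      simpa using contDiff_primitive (n := 0) u₀ (contDiff_zero.2 hv)
    exact h.contDiffOn
  · exact hinc.contDiffOn.congr hinclu
  · rw [(hasDerivAt_primitive u₀ hv 0).hasDerivWithinAt.derivWithin
      (uniqueDiffOn_Ici 0 0 self_mem_Ici), hp0, ← he, e.symm_apply_apply]
  · rw [iteratedDerivWithin_congr hinclu self_mem_Ici,
      iteratedDerivWithin_eq_iteratedDeriv (uniqueDiffOn_Ici 0) hinc.contDiffAt self_mem_Ici,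
      iteratedDeriv_succ, iteratedDeriv_one,
      funext fun t => (hasDerivAt_primitive (EnergySpace.incl A u₀) hQ.continuous t).deriv,
      (hasDerivAt_primitive (EnergySpace.incl A u₁) hq 0).deriv, hq0]

/-- The kernel, extended to a continuous integrable function on the line. -/
theorem StandingAssumption.exists_extension {τ α b c : ℝ} {g : ℝ → ℝ}
    (h : StandingAssumption A τ α b c g) : ∃ G : ℝ → ℝ, Continuous G ∧
      (∀ t, 0 ≤ t → G t = g t) ∧ ∀ t, 0 ≤ t → ∫ s in (0 : ℝ)..t, ‖G s‖ ≤ c ^ 2 := by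
  have hGg : ∀ t : ℝ, 0 ≤ t → g (max t 0) = g t := fun t ht => by rw [max_eq_left ht]
  -- The kernel is frozen at g(0) for negative times, and positivity of `g` bounds ∫₀ᵗ |g| by the
  -- full integral, hence by c².
  refine ⟨fun t => g (max t 0), ?_, hGg, fun t ht => ?_⟩
  · exact h.contDiffOn_g.continuousOn.comp_continuous (by fun_prop) fun t => le_max_right t 0
  · refine le_trans ?_ h.integral_g_lt.le
    rw [intervalIntegral.integral_of_le ht]
    have hcongr : ∫ s in Ioc 0 t, ‖g (max s 0)‖ = ∫ s in Ioc 0 t, g s := by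
      refine setIntegral_congr_fun measurableSet_Ioc fun s hs => ?_
      simp only [hGg s hs.1.le, Real.norm_of_nonneg (h.g_pos s hs.1.le).le]
    rw [hcongr]
    refine setIntegral_mono_set h.integrable_g ?_ (Ioc_subset_Ioi_self).eventuallyLE
    filter_upwards [ae_restrict_mem measurableSet_Ioi] with s hs
    exact (h.g_pos s (mem_Ioi.1 hs).le).le

end WeakForm

end MGT

theorem theorem1 {H : Type*} [NormedAddCommGroup H] [InnerProductSpace ℝ H] [CompleteSpace H]
    (A : H →ₗ.[ℝ] H) (hA : MGT.IsPositiveSelfAdjoint A)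
    (τ α b c : ℝ) (hτ : 0 < τ) (hb : 0 < b) (g : ℝ → ℝ)
    (hassum : MGT.StandingAssumption A τ α b c g)
    (u₀ u₁ : MGT.EnergySpace A) (u₂ : H) :
    ∃ u : ℝ → MGT.EnergySpace A,
      MGT.IsWeakSolution A τ α b c g u₀ u₁ u₂ u ∧
      (∀ u' : ℝ → MGT.EnergySpace A, MGT.IsWeakSolution A τ α b c g u₀ u₁ u₂ u' →
        EqOn u' u (Ici 0)) ∧
      ContDiffOn ℝ 1 u (Ici 0) ∧
      ContDiffOn ℝ 2 (fun t => MGT.EnergySpace.incl A (u t)) (Ici 0) ∧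
      derivWithin u (Ici 0) 0 = u₁ ∧
      iteratedDerivWithin 2 (fun t => MGT.EnergySpace.incl A (u t)) (Ici 0) 0 = u₂ := by
  obtain ⟨G, hG, hGg, hM⟩ := hassum.exists_extension
  obtain ⟨u, hu, h⟩ := MGT.exists_isWeakSolution (α := α) hassum.coercive hτ hb hG hGg hM u₀ u₁ u₂
  exact ⟨u, hu, fun u' hu' => hu'.eqOn hassum.coercive hτ hb hG hGg hM hu, h⟩
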